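/- Let $\mathbf F$ be a free group with a finite basis $B$. A $B$-labeled multi core graph is a finite (possibly empty or disconnected) graph $\Gamma$ with directed edges labeled by elements of $B$, in which every vertex has degree at least two (a loop counting twice) and at most one incoming and at most one outgoing $b$-edge for each $b\in B$. A morphism of such graphs is a graph morphism preserving directions and labels; it is $B$-surjective if it is onto on vertices and on edges, and injective if it is injective on both. Put $\chi(\Gamma)=\#V(\Gamma)-\#E(\Gamma)$. For a vertex $v$, let $\pi_1^{\mathrm{lab}}(\Gamma,v)\le\mathbf F$ be the group of elements spelled by the closed paths at $v$. *$B$-norm.* The norm of a partition $P$ of a finite set is $\|P\|=\sum_{\beta\in P}(|\beta|-1)$. A partition $P$ of $V(\Gamma)$ generates a $B$-surjective morphism $\eta:\Gamma\to\Delta$ if gluing the vertices of $\Gamma$ according to $P$ and then performing Stallings foldings yields $\eta$. Let $\|\eta\|_B$ be the minimum of $\|P\|$ over all partitions $P$ generating $\eta$. *Norm.* Let $\mathcal H=\{H_1,\dots,H_\ell\}$, $\ell\ge 1$, be a finite multiset of subgroups of a subgroup $J\le\mathbf F$, each considered up to conjugation in $J$. An immediate morphism over $J$ either replaces some $H_i$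 by $\langle H_i,j\rangle$, for some $j\in J$, or replaces two members $H_i,H_k$ ($i\ne k$) by the single subgroup $\langle jH_ij^{-1},H_k\rangle$, for some $j\in J$. The norm of $\mathcal H\to\{J\}$ is the smallest number of successive immediate morphisms leading from $\mathcal H$ to $\{J\}$. For a morphism $\eta:\Gamma\to\Delta$ of multi core graphs with $\Delta$ connected, let $J=\pi_1^{\mathrm{lab}}(\Delta,p)$ for a vertex $p$ of $\Delta$; for each component $\Gamma_i$ of $\Gamma$ choose a vertex $v_i\in\Gamma_i$ and let $u_i$ be the element spelled by some path in $\Delta$ from $p$ to $\eta(v_i)$, and put $H_i=u_i\,\pi_1^{\mathrm{lab}}(\Gamma_i,v_i)\,u_i^{-1}\le J$. If $\Gamma\neq\emptyset$, then $\|\eta\|$ is the norm of $\{H_i\}_i\to\{J\}$; if $\Gamma=\emptyset$, then $\|\eta\|=-\chi(\Delta)$. For general $\Delta$ with components $\Delta_1,\dots,\Delta_m$, put $\|\eta\|=\sum_{k=1}^m\big\|\eta|_{\eta^{-1}(\Delta_k)}:\eta^{-1}(\Delta_k)\to\Delta_k\big\|$. **Theorem.** Let $\eta:\Gamma\to\Delta$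 be a morphism of $B$-labeled multi core graphs. Then the minima that define $\|\eta\|$ are over non-empty sets. Let $\Sigma$ be the image of $\eta$ in $\Delta$ and let $\Gamma\overset{\bar\eta}{\twoheadrightarrow}\Sigma\overset{\iota}{\hookrightarrow}\Delta$ be the decomposition of $\eta$ into a surjective and an injective morphism. Then $$\|\eta\|=\|\bar\eta\|_B+\big[\chi(\Sigma)-\chi(\Delta)\big].$$ In particular, if $\eta$ is $B$-surjective, then $\|\eta\|=\|\eta\|_B$. -/

import Mathlib

/-- A finite `B`-labeled multi core graph.  An edge is an oriented labeled edge `u --x--> v`, recorded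
by `Adj u x v`; since the graph is immersed in the bouquet `X_B`, an edge is determined by its
initial vertex, its label and its terminal vertex, so that the edge set is a subset of `V × B × V`.
Loops and edges with different labels between the same vertices are allowed, and the graph may be
disconnected or empty. -/
structure MultiCoreGraph (B : Type*) where
  /-- the vertices -/
  V : Type*
  finite_V : Finite V
  /-- `Adj u x v`: there is an edge with label `x` from `u` to `v` -/
  Adj : V → B → V → Prop
  /-- at most one outgoing `x`-edge at every vertex -/
  out_unique : ∀ {u x v v'}, Adj u x v → Adj u x v' → v = v'
  /-- at most one incoming `x`-edge at every vertex -/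
  in_unique : ∀ {u u' x v}, Adj u x v → Adj u' x v → u = u'
  /-- every vertex has degree at least two (a loop counts twice): no leaves, no isolated vertices -/
  two_le_degree : ∀ v, 2 ≤ Nat.card {p : B × V // Adj v p.1 p.2} +
    Nat.card {p : V × B // Adj p.1 p.2 v}

namespace MultiCoreGraph

universe u v w z

attribute [instance] MultiCoreGraph.finite_V

section Basic

variable {B : Type u} (Γ : MultiCoreGraph.{u, v} B)

/-- The set of edges. -/
abbrev Edge : Type (max u v) := {e : Γ.V × B × Γ.V // Γ.Adj e.1 e.2.1 e.2.2}

/-- The Euler characteristic `#V - #E`. -/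
noncomputable def chi : ℤ := (Nat.card Γ.V : ℤ) - (Nat.card Γ.Edge : ℤ)

/-- The set of connected components: the vertices modulo the equivalence relation generated by
adjacency. -/
def Component : Type v := Quot (fun u v : Γ.V => ∃ x, Γ.Adj u x v)

/-- The component of a vertex. -/
def comp (v : Γ.V) : Γ.Component := Quot.mk _ v

/-- A vertex of a component. -/
noncomputable def base (C : Γ.Component) : Γ.V := Quot.out C

theorem comp_base (C : Γ.Component) : Γ.comp (Γ.base C) = C := Quot.out_eq C

instance : Finite Γ.Component := inferInstanceAs (Finite (Quot _))

/-- The Euler characteristic `#V - #E` of one connected component. -/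
noncomputable def compChi (C : Γ.Component) : ℤ :=
  (Nat.card {v : Γ.V // Γ.comp v = C} : ℤ) - (Nat.card {e : Γ.Edge // Γ.comp e.1.1 = C} : ℤ)

end Basic

/-- Morphisms of `B`-labeled multi core graphs: graph morphisms that preserve orientations and labels
(that is, commute with the immersions to `X_B`).  The map on edges is determined by the map on
vertices. -/
structure Hom {B : Type u} (Γ : MultiCoreGraph.{u, v} B) (Δ : MultiCoreGraph.{u, w} B) where
  /-- the map on vertices -/
  toFun : Γ.V → Δ.V
  map_adj : ∀ {a x c}, Γ.Adj a x c → Δ.Adj (toFun a) x (toFun c)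

namespace Hom

variable {B : Type u} {Γ : MultiCoreGraph.{u, v} B} {Δ : MultiCoreGraph.{u, w} B}
  {Λ : MultiCoreGraph.{u, z} B}

/-- `B`-surjective: onto on vertices and on edges. -/
def Surjective (η : Hom Γ Δ) : Prop :=
  Function.Surjective η.toFun ∧
    ∀ {p x q}, Δ.Adj p x q → ∃ a c, Γ.Adj a x c ∧ η.toFun a = p ∧ η.toFun c = q

/-- Injective on vertices (and hence on edges). -/
def Injective (η : Hom Γ Δ) : Prop := Function.Injective η.toFun

/-- Composition of morphisms: first `η`, then `θ`. -/
def trans (η : Hom Γ Δ) (θ : Hom Δ Λ) : Hom Γ Λ where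
  toFun := θ.toFun ∘ η.toFun
  map_adj h := θ.map_adj (η.map_adj h)

/-- The induced map on connected components. -/
def mapComp (η : Hom Γ Δ) : Γ.Component → Δ.Component :=
  Quot.map η.toFun (fun _ _ ⟨x, h⟩ => ⟨x, η.map_adj h⟩)

theorem mapComp_comp (η : Hom Γ Δ) (v : Γ.V) : η.mapComp (Γ.comp v) = Δ.comp (η.toFun v) := rfl

/-- The image of a morphism: the subgraph of the codomain formed by the images of all vertices and of
all edges of the domain. -/
def image [Finite B] (η : Hom Γ Δ) : MultiCoreGraph.{u, w} B where
  V := Set.range η.toFun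
  finite_V := inferInstance
  Adj p x q := ∃ a c, Γ.Adj a x c ∧ η.toFun a = p ∧ η.toFun c = q
  out_unique := by
    rintro ⟨p, hp⟩ x ⟨q, hq⟩ ⟨q', hq'⟩ ⟨a, c, h, rfl, rfl⟩ ⟨a', c', h', e, rfl⟩
    have h2 := η.map_adj h'
    rw [e] at h2
    exact Subtype.ext (Δ.out_unique (η.map_adj h) h2)
  in_unique := by
    rintro ⟨p, hp⟩ ⟨p', hp'⟩ x ⟨q, hq⟩ ⟨a, c, h, rfl, rfl⟩ ⟨a', c', h', rfl, e⟩
    have h2 := η.map_adj h'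
    rw [e] at h2
    exact Subtype.ext (Δ.in_unique (η.map_adj h) h2)
  two_le_degree := by
    rintro ⟨_, a, rfl⟩
    refine (Γ.two_le_degree a).trans (Nat.add_le_add ?_ ?_)
    · refine Nat.card_le_card_of_injective
        (fun p => ⟨(p.1.1, ⟨η.toFun p.1.2, p.1.2, rfl⟩), a, p.1.2, p.2, rfl, rfl⟩) ?_
      rintro ⟨⟨x, c⟩, h⟩ ⟨⟨x', c'⟩, h'⟩ e
      obtain rfl : x = x' := congrArg (fun t => t.1.1) e
      obtain rfl := Γ.out_unique h h'
      rfl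
    · refine Nat.card_le_card_of_injective
        (fun p => ⟨(⟨η.toFun p.1.1, p.1.1, rfl⟩, p.1.2), p.1.1, a, p.2, rfl, rfl⟩) ?_
      rintro ⟨⟨c, x⟩, h⟩ ⟨⟨c', x'⟩, h'⟩ e
      obtain rfl : x = x' := congrArg (fun t => t.1.2) e
      obtain rfl := Γ.in_unique h h'
      rfl

/-- The surjective part `Γ → Σ` of a morphism. -/
def toImage [Finite B] (η : Hom Γ Δ) : Hom Γ η.image where
  toFun a := ⟨η.toFun a, a, rfl⟩
  map_adj {a _ c} h := ⟨a, c, h, rfl, rfl⟩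

/-- The injective part `Σ → Δ` of a morphism. -/
def imageIncl [Finite B] (η : Hom Γ Δ) : Hom η.image Δ where
  toFun p := p.1
  map_adj := by
    rintro ⟨_, _⟩ x ⟨_, _⟩ ⟨a, c, h, rfl, rfl⟩
    exact η.map_adj h

theorem toImage_surjective [Finite B] (η : Hom Γ Δ) : η.toImage.Surjective := by
  refine ⟨?_, ?_⟩
  · rintro ⟨_, a, rfl⟩
    exact ⟨a, rfl⟩
  · rintro p x q ⟨a, c, h, e, e'⟩
    exact ⟨a, c, h, Subtype.ext e, Subtype.ext e'⟩

theorem imageIncl_injective [Finite B] (η : Hom Γ Δ) : η.imageIncl.Injective :=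
  Subtype.val_injective

theorem toImage_trans_imageIncl [Finite B] (η : Hom Γ Δ) : η.toImage.trans η.imageIncl = η := rfl

end Hom

section BNorm

variable {B : Type u} {Γ : MultiCoreGraph.{u, v} B} {Δ : MultiCoreGraph.{u, w} B}

/-- `FoldRel P a c`: the vertices `a` and `c` become identified when one glues the vertices of `Γ`
according to the partition `P` and then performs Stallings foldings iteratively: two edges with the
same label and the same tail (head) after previous identifications get their heads (tails)
identified. -/
inductive FoldRel (P : Setoid Γ.V) : Γ.V → Γ.V → Prop
  | glue {a c} : P a c → FoldRel P a c
  | symm {a c} : FoldRel P a c → FoldRel P c a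
  | trans {a c d} : FoldRel P a c → FoldRel P c d → FoldRel P a d
  | foldHeads {a a' x c c'} : Γ.Adj a x c → Γ.Adj a' x c' → FoldRel P a a' → FoldRel P c c'
  | foldTails {a a' x c c'} : Γ.Adj a x c → Γ.Adj a' x c' → FoldRel P c c' → FoldRel P a a'

/-- The partition of the vertices produced from `P` by folding. -/
def foldSetoid (P : Setoid Γ.V) : Setoid Γ.V where
  r := FoldRel P
  iseqv := ⟨fun a => .glue (P.refl a), .symm, .trans⟩

/-- The norm `∑ (|β| - 1)` of a partition, over its blocks `β` (which are non-empty). -/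
noncomputable def partitionNorm {X : Type*} (P : Setoid X) : ℕ :=
  ∑ᶠ β ∈ P.classes, (β.ncard - 1)

/-- The partition `P` generates the `B`-surjective morphism `η`: gluing according to `P` and then
folding yields the partition of the vertices into the fibers of `η`.  That partition determines the
surjective morphism `η` (up to an isomorphism of the codomain), because the edges of the codomain are
the images of the edges of the domain. -/
def Generates (P : Setoid Γ.V) (η : Hom Γ Δ) : Prop :=
  η.Surjective ∧ foldSetoid P = Setoid.ker η.toFun

/-- A `B`-surjective morphism is generated by some partition (its own fibers), so that the minimum in
the definition of the `B`-norm exists. -/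
theorem generates_ker {η : Hom Γ Δ} (hη : η.Surjective) : Generates (Setoid.ker η.toFun) η := by
  refine ⟨hη, Setoid.ext fun a c => ⟨fun h => ?_, fun h => FoldRel.glue h⟩⟩
  have h' : FoldRel (Setoid.ker η.toFun) a c := h
  clear h
  change η.toFun a = η.toFun c
  induction h' with
  | glue h => exact h
  | symm h ih => exact ih.symm
  | trans h h' ih ih' => exact ih.trans ih'
  | foldHeads h h' hr ih =>
    have h2 := η.map_adj h
    rw [ih] at h2
    exact Δ.out_unique h2 (η.map_adj h')
  | foldTails h h' hr ih =>
    have h2 := η.map_adj h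
    rw [ih] at h2
    exact Δ.in_unique h2 (η.map_adj h')

/-- The `B`-norm of a `B`-surjective morphism: the smallest norm of a partition generating it. -/
noncomputable def BNorm (η : Hom Γ Δ) : ℕ :=
  sInf {n | ∃ P : Setoid Γ.V, Generates P η ∧ partitionNorm P = n}

end BNorm

section Immediate

variable {F : Type z} [Group F]

/-- The conjugate `g H g⁻¹`. -/
def conjSubgroup (g : F) (H : Subgroup F) : Subgroup F := H.map (MulAut.conj g).toMonoidHom

/-- The immediate morphisms over `J`.  A finite multiset of subgroups of `J` stands for the multiset of
their conjugacy classes together with the corresponding morphism to `J`; replacing a subgroup by a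
`J`-conjugate gives the same object over `J`, and it does not affect which objects over `J` can be
reached, since the element `j ∈ J` below is arbitrary.
* `adjoin`: some `H` is replaced by `⟨H, j⟩`;
* `merge`: two members `H`, `K` are replaced by the single subgroup `⟨j H j⁻¹, K⟩`. -/
inductive Immediate (J : Subgroup F) : Multiset (Subgroup F) → Multiset (Subgroup F) → Prop
  | adjoin (s : Multiset (Subgroup F)) (H : Subgroup F) (j : F) (hj : j ∈ J) :
      Immediate J (H ::ₘ s) ((H ⊔ Subgroup.zpowers j) ::ₘ s)
  | merge (s : Multiset (Subgroup F)) (H K : Subgroup F) (j : F) (hj : j ∈ J) :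
      Immediate J (H ::ₘ K ::ₘ s) ((conjSubgroup j H ⊔ K) ::ₘ s)

/-- `ImmediateChain J n s t`: a sequence of `n` immediate morphisms over `J` leads from `s` to `t`. -/
inductive ImmediateChain (J : Subgroup F) :
    ℕ → Multiset (Subgroup F) → Multiset (Subgroup F) → Prop
  | nil (s : Multiset (Subgroup F)) : ImmediateChain J 0 s s
  | cons {n : ℕ} {s t r : Multiset (Subgroup F)} :
      Immediate J s t → ImmediateChain J n t r → ImmediateChain J (n + 1) s r

/-- The norm of the morphism from a non-empty multiset `s` of subgroups of `J` to `{J}`: the smallest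
number of immediate morphisms whose composition is this morphism. -/
noncomputable def subgroupNorm (J : Subgroup F) (s : Multiset (Subgroup F)) : ℕ :=
  sInf {n | ImmediateChain J n s {J}}

end Immediate

section LabeledPi1

variable {B : Type u} {F : Type z} [Group F]

/-- `PathLabel b Γ p q g`: some path in `Γ` from `p` to `q`, which may traverse edges backwards,
spells the element `g` of the free group `F` with basis `b`. -/
inductive PathLabel (b : FreeGroupBasis B F) (Γ : MultiCoreGraph.{u, v} B) : Γ.V → Γ.V → F → Prop
  | nil (p : Γ.V) : PathLabel b Γ p p 1
  | fwd {p q r : Γ.V} {x : B} {g : F} :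
      Γ.Adj p x q → PathLabel b Γ q r g → PathLabel b Γ p r (b x * g)
  | bwd {p q r : Γ.V} {x : B} {g : F} :
      Γ.Adj q x p → PathLabel b Γ q r g → PathLabel b Γ p r ((b x)⁻¹ * g)

variable {b : FreeGroupBasis B F} {Γ : MultiCoreGraph.{u, v} B} {Δ : MultiCoreGraph.{u, w} B}

theorem PathLabel.mul {p q r : Γ.V} {g h : F} (h1 : PathLabel b Γ p q g)
    (h2 : PathLabel b Γ q r h) : PathLabel b Γ p r (g * h) := by
  induction h1 with
  | nil p => simpa using h2
  | fwd e _ ih => rw [mul_assoc]; exact .fwd e (ih h2)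
  | bwd e _ ih => rw [mul_assoc]; exact .bwd e (ih h2)

theorem PathLabel.inv {p q : Γ.V} {g : F} (h : PathLabel b Γ p q g) :
    PathLabel b Γ q p g⁻¹ := by
  induction h with
  | nil p => simpa using PathLabel.nil p
  | fwd e _ ih =>
    have := ih.mul (.bwd e (.nil _))
    simpa using this
  | bwd e _ ih =>
    have := ih.mul (.fwd e (.nil _))
    simpa using this

theorem PathLabel.map (η : Hom Γ Δ) {p q : Γ.V} {g : F} (h : PathLabel b Γ p q g) :
    PathLabel b Δ (η.toFun p) (η.toFun q) g := by
  induction h with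
  | nil p => exact .nil _
  | fwd e _ ih => exact .fwd (η.map_adj e) ih
  | bwd e _ ih => exact .bwd (η.map_adj e) ih

theorem exists_pathLabel (b : FreeGroupBasis B F) {p q : Γ.V} (h : Γ.comp p = Γ.comp q) :
    ∃ g, PathLabel b Γ p q g := by
  have h' := Quot.eqvGen_exact h
  induction h' with
  | rel p q e => obtain ⟨x, e⟩ := e; exact ⟨_, .fwd e (.nil _)⟩
  | refl p => exact ⟨1, .nil p⟩
  | symm p q hr ih => obtain ⟨g, hg⟩ := ih (Quot.eqvGen_sound hr); exact ⟨_, hg.inv⟩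
  | trans p q r hr hr' ih ih' =>
    obtain ⟨g, hg⟩ := ih (Quot.eqvGen_sound hr)
    obtain ⟨g', hg'⟩ := ih' (Quot.eqvGen_sound hr')
    exact ⟨_, hg.mul hg'⟩

/-- The labeled fundamental group: the subgroup of `F` of all labels of closed paths at `p`. -/
def pi1Lab (b : FreeGroupBasis B F) (Γ : MultiCoreGraph.{u, v} B) (p : Γ.V) : Subgroup F where
  carrier := {g | PathLabel b Γ p p g}
  one_mem' := .nil p
  mul_mem' h h' := h.mul h'
  inv_mem' h := h.inv

/-- For a component `C` of `Δ` and a component `D` of `Γ` that is mapped into `C`, the label of a path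
in `Δ` from the chosen vertex of `C` to the image of the chosen vertex of `D`. -/
noncomputable def connector (b : FreeGroupBasis B F) (η : Hom Γ Δ) (C : Δ.Component)
    (D : {D : Γ.Component // η.mapComp D = C}) : F :=
  Classical.choose (exists_pathLabel b (p := Δ.base C) (q := η.toFun (Γ.base D.1))
    (by rw [comp_base, ← Hom.mapComp_comp, comp_base, D.2]))

theorem connector_spec (b : FreeGroupBasis B F) (η : Hom Γ Δ) (C : Δ.Component)
    (D : {D : Γ.Component // η.mapComp D = C}) :
    PathLabel b Δ (Δ.base C) (η.toFun (Γ.base D.1)) (connector b η C D) :=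
  Classical.choose_spec (exists_pathLabel b (p := Δ.base C) (q := η.toFun (Γ.base D.1))
    (by rw [comp_base, ← Hom.mapComp_comp, comp_base, D.2]))

/-- The fundamental group `J` of the component `C`, as a subgroup of `F`. -/
noncomputable def targetGroup (b : FreeGroupBasis B F) (Δ : MultiCoreGraph.{u, w} B)
    (C : Δ.Component) : Subgroup F := pi1Lab b Δ (Δ.base C)

/-- The subgroup of `J` that corresponds to the component `D` of `Γ` under the morphism `η`. -/
noncomputable def fiberGroup (b : FreeGroupBasis B F) (η : Hom Γ Δ) (C : Δ.Component)
    (D : {D : Γ.Component // η.mapComp D = C}) : Subgroup F :=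
  conjSubgroup (connector b η C D) (pi1Lab b Γ (Γ.base D.1))

theorem fiberGroup_le (b : FreeGroupBasis B F) (η : Hom Γ Δ) (C : Δ.Component)
    (D : {D : Γ.Component // η.mapComp D = C}) : fiberGroup b η C D ≤ targetGroup b Δ C := by
  rintro _ ⟨h, hh, rfl⟩
  have h1 : PathLabel b Γ (Γ.base D.1) (Γ.base D.1) h := hh
  have h2 := connector_spec b η C D
  exact (h2.mul (h1.map η)).mul h2.inv

open Classical in
/-- The multiset of subgroups of `J` that corresponds to the restriction `η⁻¹(C) → C` of `η`, one for
each component of `η⁻¹(C)`. -/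
noncomputable def fiberGroups (b : FreeGroupBasis B F) (η : Hom Γ Δ) (C : Δ.Component) :
    Multiset (Subgroup F) :=
  letI := Fintype.ofFinite {D : Γ.Component // η.mapComp D = C}
  (Finset.univ : Finset {D : Γ.Component // η.mapComp D = C}).val.map (fiberGroup b η C)

open Classical in
/-- The norm of the restriction `η⁻¹(C) → C` of `η` to one component `C` of the codomain; it is
`-χ(C)` when `η⁻¹(C)` is empty. -/
noncomputable def compNorm (b : FreeGroupBasis B F) (η : Hom Γ Δ) (C : Δ.Component) : ℤ :=
  if ∃ D, η.mapComp D = C then (subgroupNorm (targetGroup b Δ C) (fiberGroups b η C) : ℤ)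
  else - Δ.compChi C

/-- The basis-independent norm of a morphism: the sum of the norms of the restrictions over the
components of the codomain. -/
noncomputable def algNorm (b : FreeGroupBasis B F) (η : Hom Γ Δ) : ℤ :=
  ∑ᶠ C : Δ.Component, compNorm b η C

end LabeledPi1

end MultiCoreGraph

/-! Both sides of the formula count how many extra generators turn the labeled fundamental groupoid
of Γ into the groupoid induced from Δ on the vertices of Γ. A finite set `T` of triples (a, g, c) is
generating (`Gen`) if each g labels a path in Δ from η(a) to η(c), and the edges of Γ together with
`T` spell all such labels. An immediate morphism costs one triple: adjoining j is a loop, merging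
two subgroups is an edge between two components. Hence the norms over the components of Δ that meet
the image add up to the least size of a generating `T`. Let e and v be the numbers of edges and
vertices outside Σ in these components. The heart of the proof is that the least size is ‖η̄‖_B + e
− v (`sum_subgroupNorm`). A component missed by the image contributes −χ to either side, and e − v
minus the sum of χ over the missed components is χ(Σ) − χ(Δ).

Upper bound (`exists_gen_of_foldG`). A partition of norm n can be replaced by n glued pairs, which
are triples with label 1. Two vertices become identified by gluing and folding exactly when a path
with label 1 joins them (`FoldG.gpath`, `FoldG.of_gpath`), so these triples account for Σ. A forest
of v outer edges attaches the v outer vertices to Σ, and each of the other e − v outer edges gives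
one triple.

Lower bound (`Gen.exists_pairs`). Write the label of each triple as a word in the basis and replace
the triple by a chain of separate edges. A word with m letters costs m edges and m + 1 glued pairs,
so that #pairs − #edges is at most |T|. Gluing and folding now identify all vertices with the same
image. The edges also cover all components that meet the image, because a nonempty proper subgraph
of a connected core graph cannot carry its whole groupoid (`subgraph_eq_of_generates`); this is
where degree at least two is decisive. A separate edge that folds onto another edge is deleted
together with one pair (`FoldG.remove_edge`), until the separate edges correspond to the e outer
edges. These take part in no further fold, so their 2e end points may be treated as isolated
vertices. Keeping one end point over each outer vertex and contracting the others removes 2e − v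
pairs. At most |T| + e − (2e − v) = |T| − e + v pairs remain, and those among vertices of Γ generate
η̄. -/

namespace MultiCoreGraph

/-! ### Labeled groupoids and Stallings folding -/

section Paths

variable {V V' F B : Type*} [Group F]

/-- The groupoid generated by a relation whose edges are labeled by elements of a group. -/
inductive GPath (S : V → F → V → Prop) : V → V → F → Prop
  | nil (p) : GPath S p p 1
  | fwd {p q r g h} : S p g q → GPath S q r h → GPath S p r (g * h)
  | bwd {p q r g h} : S q g p → GPath S q r h → GPath S p r (g⁻¹ * h)

namespace GPath

variable {S : V → F → V → Prop} {S' : V' → F → V' → Prop} {p q r : V} {g h : F}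

theorem mul (h1 : GPath S p q g) (h2 : GPath S q r h) : GPath S p r (g * h) := by
  induction h1 with
  | nil p => simpa using h2
  | fwd e _ ih => rw [mul_assoc]; exact .fwd e (ih h2)
  | bwd e _ ih => rw [mul_assoc]; exact .bwd e (ih h2)

theorem single (h : S p g q) : GPath S p q g := by simpa using GPath.fwd h (.nil q)

theorem inv (h : GPath S p q g) : GPath S q p g⁻¹ := by
  induction h with
  | nil p => simpa using GPath.nil p
  | fwd e _ ih => simpa using ih.mul (.bwd e (.nil _))
  | bwd e _ ih => simpa using ih.mul (.fwd e (.nil _))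

theorem cast {g' : F} (h : GPath S p q g) (e : g = g') : GPath S p q g' := e ▸ h

/-- Transport of paths along a map of vertices and a gauge transformation `φ`, inside a union `I` of
components. -/
theorem gaugeOn (I : V → Prop) (f : V → V') (φ : V → F)
    (hI : ∀ p g q, S p g q → (I p ↔ I q))
    (hS : ∀ p g q, I p → I q → S p g q → GPath S' (f p) (f q) (φ p * g * (φ q)⁻¹))
    (h : GPath S p q g) (hp : I p) : GPath S' (f p) (f q) (φ p * g * (φ q)⁻¹) := by
  induction h with
  | nil p => simpa using GPath.nil (S := S') (f p)
  | fwd e _ ih =>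
    have hq := (hI _ _ _ e).1 hp
    exact ((hS _ _ _ hp hq e).mul (ih hq)).cast (by group)
  | bwd e _ ih =>
    have hq := (hI _ _ _ e).2 hp
    exact ((hS _ _ _ hq hp e).inv.mul (ih hq)).cast (by group)

theorem gauge (f : V → V') (φ : V → F)
    (hS : ∀ p g q, S p g q → GPath S' (f p) (f q) (φ p * g * (φ q)⁻¹))
    (h : GPath S p q g) : GPath S' (f p) (f q) (φ p * g * (φ q)⁻¹) :=
  gaugeOn (fun _ => True) f φ (fun _ _ _ _ => Iff.rfl) (fun p g q _ _ => hS p g q) h trivial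

theorem map (f : V → V') (hS : ∀ p g q, S p g q → GPath S' (f p) (f q) g)
    (h : GPath S p q g) : GPath S' (f p) (f q) g := by
  simpa using gauge (S' := S') f (fun _ => 1) (fun p g q e => by simpa using hS p g q e) h

theorem bind {S' : V → F → V → Prop} (hS : ∀ p g q, S p g q → GPath S' p q g)
    (h : GPath S p q g) : GPath S' p q g := map id hS h

theorem mono {S' : V → F → V → Prop} (hS : ∀ p g q, S p g q → S' p g q)
    (h : GPath S p q g) : GPath S' p q g := h.bind fun p g q e => .single (hS p g q e)

/-- A label moves the terminal vertex to the initial one; with this convention concatenation of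
paths matches composition of permutations. -/
theorem act {X : Type*} (φ : F →* Equiv.Perm X) (f : V → X)
    (hS : ∀ p g q, S p g q → φ g (f q) = f p) (h : GPath S p q g) : φ g (f q) = f p := by
  induction h with
  | nil p => simp
  | fwd e _ ih => rw [map_mul, Equiv.Perm.mul_apply, ih, hS _ _ _ e]
  | bwd e _ ih =>
    rw [map_mul, Equiv.Perm.mul_apply, ih, map_inv, Equiv.Perm.inv_eq_iff_eq, hS _ _ _ e]

end GPath

/-- The vertex group of the groupoid generated by `S`. -/
def vertexGroup (S : V → F → V → Prop) (p : V) : Subgroup F where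
  carrier := {g | GPath S p p g}
  one_mem' := .nil p
  mul_mem' h h' := h.mul h'
  inv_mem' h := h.inv

/-- The relation on vertices labeled by group elements that comes from a `B`-labeled graph. -/
def lab (b : FreeGroupBasis B F) (Adj : V → B → V → Prop) : V → F → V → Prop :=
  fun u g v => ∃ x, Adj u x v ∧ g = b x

theorem pathLabel_iff {b : FreeGroupBasis B F} {Γ : MultiCoreGraph B} {p q : Γ.V} {g : F} :
    PathLabel b Γ p q g ↔ GPath (lab b Γ.Adj) p q g := by
  constructor
  · intro h
    induction h with
    | nil p => exact .nil p
    | fwd e _ ih => exact .fwd ⟨_, e, rfl⟩ ih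
    | bwd e _ ih => exact .bwd ⟨_, e, rfl⟩ ih
  · intro h
    induction h with
    | nil p => exact .nil p
    | fwd e _ ih => obtain ⟨x, e, rfl⟩ := e; exact .fwd e ih
    | bwd e _ ih => obtain ⟨x, e, rfl⟩ := e; exact .bwd e ih

theorem comp_eq_of_adj {Γ : MultiCoreGraph B} {p q : Γ.V} {x : B} (h : Γ.Adj p x q) :
    Γ.comp p = Γ.comp q := Quot.sound ⟨x, h⟩

theorem PathLabel.comp_eq {b : FreeGroupBasis B F} {Γ : MultiCoreGraph B} {p q : Γ.V} {g : F}
    (h : PathLabel b Γ p q g) : Γ.comp p = Γ.comp q := by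
  induction h with
  | nil p => rfl
  | fwd e _ ih => exact (comp_eq_of_adj e).trans ih
  | bwd e _ ih => exact (comp_eq_of_adj e).symm.trans ih

open Classical in
/-- A partial injection of `α` extends to a permutation of two copies of `α`. -/
theorem exists_perm_extending {α : Type*} (r : α → α → Prop)
    (h1 : ∀ a c c', r a c → r a c' → c = c') (h2 : ∀ a a' c, r a c → r a' c → a = a') :
    ∃ σ : Equiv.Perm (α ⊕ α), ∀ a c, r a c → σ (.inl a) = .inl c := by
  -- The second copy absorbs the defects: a point without an image goes to its own copy, and the
  -- copy of a point outside the range goes back to that point. The copy of any other point goes to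
  -- the copy of its preimage. `f'` is the same recipe for the converse relation.
  let f : α ⊕ α → α ⊕ α := Sum.elim
    (fun a => if h : ∃ c, r a c then .inl h.choose else .inr a)
    (fun c => if h : ∃ a, r a c then .inr h.choose else .inl c)
  let f' : α ⊕ α → α ⊕ α := Sum.elim
    (fun c => if h : ∃ a, r a c then .inl h.choose else .inr c)
    (fun a => if h : ∃ c, r a c then .inr h.choose else .inl a)
  have e1 : ∀ a c, r a c → f (.inl a) = .inl c := fun a c h => by
    have h' : ∃ c, r a c := ⟨c, h⟩
    simp only [f, Sum.elim_inl, dif_pos h']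
    rw [h1 a _ _ h'.choose_spec h]
  have e2 : ∀ a c, r a c → f (.inr c) = .inr a := fun a c h => by
    have h' : ∃ a, r a c := ⟨a, h⟩
    simp only [f, Sum.elim_inr, dif_pos h']
    rw [h2 _ _ c h'.choose_spec h]
  have e3 : ∀ a c, r a c → f' (.inl c) = .inl a := fun a c h => by
    have h' : ∃ a, r a c := ⟨a, h⟩
    simp only [f', Sum.elim_inl, dif_pos h']
    rw [h2 _ _ c h'.choose_spec h]
  have e4 : ∀ a c, r a c → f' (.inr a) = .inr c := fun a c h => by
    have h' : ∃ c, r a c := ⟨c, h⟩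
    simp only [f', Sum.elim_inr, dif_pos h']
    rw [h1 a _ _ h'.choose_spec h]
  refine ⟨⟨f, f', ?_, ?_⟩, e1⟩
  · rintro (a | c)
    · by_cases h : ∃ c, r a c
      · obtain ⟨c, h⟩ := h; rw [e1 a c h, e3 a c h]
      · simp [f, f', h]
    · by_cases h : ∃ a, r a c
      · obtain ⟨a, h⟩ := h; rw [e2 a c h, e4 a c h]
      · simp [f, f', h]
  · rintro (c | a)
    · by_cases h : ∃ a, r a c
      · obtain ⟨a, h⟩ := h; rw [e3 a c h, e1 a c h]
      · simp [f, f', h]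
    · by_cases h : ∃ c, r a c
      · obtain ⟨c, h⟩ := h; rw [e4 a c h, e2 a c h]
      · simp [f, f', h]

/-- In a folded graph the label of a path and its terminal vertex determine the initial vertex. -/
theorem GPath.unique_of_folded (b : FreeGroupBasis B F) {Adj : V → B → V → Prop}
    (h1 : ∀ u x v v', Adj u x v → Adj u x v' → v = v')
    (h2 : ∀ u u' x v, Adj u x v → Adj u' x v → u = u') {p p' q : V} {g : F}
    (h : GPath (lab b Adj) p q g) (h' : GPath (lab b Adj) p' q g) : p = p' := by
  -- Each basis letter acts by a permutation of two copies of `V`, so the free group acts. Inverses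
  -- appear because a label carries the end of a path to its beginning.
  choose σ hσ using fun x => exists_perm_extending (fun u v => Adj u x v)
    (fun a c c' => h1 a x c c') (fun a a' c => h2 a a' x c)
  have key : ∀ p g q, lab b Adj p g q →
      b.lift (fun x => (σ x)⁻¹) g (Sum.inl q) = (Sum.inl p : V ⊕ V) := by
    rintro p _ q ⟨x, e, rfl⟩
    rw [FreeGroupBasis.lift_apply_apply, FreeGroupBasis.repr_apply_coe, FreeGroup.lift_apply_of,
      Equiv.Perm.inv_eq_iff_eq, hσ x _ _ e]
  exact Sum.inl_injective ((h.act _ Sum.inl key).symm.trans (h'.act _ Sum.inl key))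

/-- The equivalence relation generated by gluing along `P` and folding. -/
inductive FoldG (Adj : V → B → V → Prop) (P : V → V → Prop) : V → V → Prop
  | refl (a) : FoldG Adj P a a
  | glue {a c} : P a c → FoldG Adj P a c
  | symm {a c} : FoldG Adj P a c → FoldG Adj P c a
  | trans {a c d} : FoldG Adj P a c → FoldG Adj P c d → FoldG Adj P a d
  | foldHeads {a a' x c c'} : Adj a x c → Adj a' x c' → FoldG Adj P a a' → FoldG Adj P c c'
  | foldTails {a a' x c c'} : Adj a x c → Adj a' x c' → FoldG Adj P c c' → FoldG Adj P a a'

namespace FoldG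

variable {Adj : V → B → V → Prop} {P : V → V → Prop}

theorem map {Adj' : V' → B → V' → Prop} {P' : V' → V' → Prop} (f : V → V')
    (hA : ∀ u x v, Adj u x v → Adj' (f u) x (f v))
    (hP : ∀ u v, P u v → FoldG Adj' P' (f u) (f v)) {u v : V} (h : FoldG Adj P u v) :
    FoldG Adj' P' (f u) (f v) := by
  induction h with
  | refl a => exact .refl _
  | glue h => exact hP _ _ h
  | symm _ ih => exact ih.symm
  | trans _ _ ih ih' => exact ih.trans ih'
  | foldHeads h h' _ ih => exact .foldHeads (hA _ _ _ h) (hA _ _ _ h') ih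
  | foldTails h h' _ ih => exact .foldTails (hA _ _ _ h) (hA _ _ _ h') ih

theorem bind {P' : V → V → Prop} (hP : ∀ u v, P u v → FoldG Adj P' u v) {u v : V}
    (h : FoldG Adj P u v) : FoldG Adj P' u v := h.map id (fun _ _ _ => id) hP

/-- The fold closure is contained in every equivalence relation that is closed under folding. -/
theorem le {r : V → V → Prop} (hr : Equivalence r) (hP : ∀ u v, P u v → r u v)
    (h1 : ∀ a a' x c c', Adj a x c → Adj a' x c' → r a a' → r c c')
    (h2 : ∀ a a' x c c', Adj a x c → Adj a' x c' → r c c' → r a a') {u v : V}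
    (h : FoldG Adj P u v) : r u v := by
  induction h with
  | refl a => exact hr.refl _
  | glue h => exact hP _ _ h
  | symm _ ih => exact hr.symm ih
  | trans _ _ ih ih' => exact hr.trans ih ih'
  | foldHeads h h' _ ih => exact h1 _ _ _ _ _ h h' ih
  | foldTails h h' _ ih => exact h2 _ _ _ _ _ h h' ih

theorem equivalence : Equivalence (FoldG Adj P) := ⟨.refl, .symm, .trans⟩

/-- A morphism to a folded graph that is constant on the pairs of `P` is constant on the classes of
the fold closure. -/
theorem apply_eq {X : Type*} {AdjX : X → B → X → Prop} (f : V → X)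
    (h1 : ∀ u x v v', AdjX u x v → AdjX u x v' → v = v')
    (h2 : ∀ u u' x v, AdjX u x v → AdjX u' x v → u = u')
    (hA : ∀ u x v, Adj u x v → AdjX (f u) x (f v)) (hP : ∀ u v, P u v → f u = f v) {u v : V}
    (h : FoldG Adj P u v) : f u = f v := by
  refine h.le (r := fun u v => f u = f v) ⟨fun _ => rfl, Eq.symm, Eq.trans⟩ hP ?_ ?_
  · intro a a' x c c' e e' h
    have := hA _ _ _ e
    rw [h] at this
    exact h1 _ _ _ _ this (hA _ _ _ e')
  · intro a a' x c c' e e' h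
    have := hA _ _ _ e
    rw [h] at this
    exact h2 _ _ _ _ this (hA _ _ _ e')

/-- Reversing all edges exchanges the two kinds of folds; this reduces statements about heads to
statements about tails. -/
theorem flip {u v : V} (h : FoldG Adj P u v) : FoldG (fun u x v => Adj v x u) P u v := by
  induction h with
  | refl a => exact .refl _
  | glue h => exact .glue h
  | symm _ ih => exact ih.symm
  | trans _ _ ih ih' => exact ih.trans ih'
  | foldHeads h h' _ ih => exact foldTails (Adj := fun u x v => Adj v x u) h h' ih
  | foldTails h h' _ ih => exact foldHeads (Adj := fun u x v => Adj v x u) h h' ih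

/-- The quotient by the fold closure is a folded graph in which the glued pairs become trivial. A
path with label `1` descends to it and has the label and the terminal vertex of a constant path,
hence also its initial vertex. -/
theorem of_gpath (b : FreeGroupBasis B F) {u v : V}
    (h : GPath (fun u g v => lab b Adj u g v ∨ (g = 1 ∧ P u v)) u v 1) : FoldG Adj P u v := by
  let s : Setoid V := ⟨FoldG Adj P, equivalence⟩
  let AdjQ : Quotient s → B → Quotient s → Prop :=
    fun p x q => ∃ u v, Adj u x v ∧ Quotient.mk s u = p ∧ Quotient.mk s v = q
  have hq : GPath (lab b AdjQ) (Quotient.mk s u) (Quotient.mk s v) 1 := by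
    refine h.map (Quotient.mk s) ?_
    rintro p g q (⟨x, e, rfl⟩ | ⟨rfl, e⟩)
    · exact .single ⟨x, ⟨p, q, e, rfl, rfl⟩, rfl⟩
    · rw [Quotient.sound (s := s) (a := p) (b := q) (.glue e)]
      exact .nil _
  refine Quotient.exact (s := s) (hq.unique_of_folded b ?_ ?_ (.nil _))
  · rintro _ x _ _ ⟨u, v, e, rfl, rfl⟩ ⟨u', v', e', h, rfl⟩
    exact Quotient.sound (s := s) (.foldHeads e e' (Quotient.exact (s := s) h).symm)
  · rintro _ _ x _ ⟨u, v, e, rfl, rfl⟩ ⟨u', v', e', rfl, h⟩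
    exact Quotient.sound (s := s) (.foldTails e e' (Quotient.exact (s := s) h).symm)

/-- Being joined by a path with label `1` is an equivalence relation, and it is closed under folding
because a letter cancels against its inverse. -/
theorem gpath (b : FreeGroupBasis B F) {u v : V} (h : FoldG Adj P u v) :
    GPath (fun u g v => lab b Adj u g v ∨ (g = 1 ∧ P u v)) u v 1 := by
  refine h.le (r := fun u v => GPath _ u v 1)
    ⟨.nil, fun h => by simpa using h.inv, fun h h' => by simpa using h.mul h'⟩
    (fun _ _ h => .single (.inr ⟨rfl, h⟩)) ?_ ?_
  · intro a a' x c c' e e' h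
    exact (GPath.bwd (.inl ⟨x, e, rfl⟩) (h.mul (.single (.inl ⟨x, e', rfl⟩)))).cast (by group)
  · intro a a' x c c' e e' h
    exact (GPath.fwd (.inl ⟨x, e, rfl⟩) (h.mul (.bwd (.inl ⟨x, e', rfl⟩) (.nil _)))).cast (by group)

end FoldG

end Paths

/-! ### Removing glued pairs along with isolated vertices and redundant edges -/

namespace FoldG

variable {V B : Type*} {Adj : V → B → V → Prop}

open Classical in
/-- Contracting an isolated vertex that is glued to another vertex removes one pair. -/
theorem contract {L : Finset (V × V)} {a u : V} (ha : ∀ x v, ¬ Adj a x v ∧ ¬ Adj v x a)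
    (hu : u ≠ a) (h : FoldG Adj (fun u v => (u, v) ∈ L) a u) :
    ∃ y, y ≠ a ∧ FoldG Adj (fun u v => (u, v) ∈ L) a y ∧ ((a, y) ∈ L ∨ (y, a) ∈ L) ∧
      ∃ L' : Finset (V × V), L'.card + 1 ≤ L.card ∧
        (∀ p ∈ L', ∃ t ∈ L, p = (Function.update id a y t.1, Function.update id a y t.2)) ∧
        ∀ u v, FoldG Adj (fun u v => (u, v) ∈ L) u v →
          FoldG Adj (fun u v => (u, v) ∈ L') (Function.update id a y u)
            (Function.update id a y v) := by
  -- If no pair linked `a` to another vertex, then `{a}` would be a class of its own, since an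
  -- isolated vertex takes part in no fold.
  obtain ⟨y, hya, t, ht, hty⟩ : ∃ y, y ≠ a ∧ ∃ t ∈ L, t = (a, y) ∨ t = (y, a) := by
    by_contra! hc
    refine hu ((h.le (r := fun u v => u = a ↔ v = a) ⟨fun _ => Iff.rfl, Iff.symm, Iff.trans⟩
      ?_ ?_ ?_).1 rfl)
    · intro u v huv
      constructor
      · rintro rfl
        by_contra hv
        exact (hc v hv _ huv).1 rfl
      · rintro rfl
        by_contra hv
        exact (hc u hv _ huv).2 rfl
    · intro u u' x v v' e e' _
      refine iff_of_false ?_ ?_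
      · rintro rfl; exact (ha x u).2 e
      · rintro rfl; exact (ha x u').2 e'
    · intro u u' x v v' e e' _
      refine iff_of_false ?_ ?_
      · rintro rfl; exact (ha x v).1 e
      · rintro rfl; exact (ha x v').1 e'
  have hL : (a, y) ∈ L ∨ (y, a) ∈ L := by
    rcases hty with rfl | rfl
    · exact .inl ht
    · exact .inr ht
  refine ⟨y, hya, ?_, hL, (L.erase t).image
    (fun p => (Function.update id a y p.1, Function.update id a y p.2)), ?_, ?_, ?_⟩
  · rcases hL with h | h
    · exact .glue h
    · exact .symm (.glue h)
  · refine (Nat.add_le_add_right Finset.card_image_le 1).trans ?_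
    rw [Finset.card_erase_add_one ht]
  · intro p hp
    obtain ⟨s, hs, rfl⟩ := Finset.mem_image.1 hp
    exact ⟨s, Finset.mem_of_mem_erase hs, rfl⟩
  · intro u v huv
    refine huv.map _ ?_ ?_
    · intro u x v e
      have h1 : u ≠ a := by rintro rfl; exact (ha x v).1 e
      have h2 : v ≠ a := by rintro rfl; exact (ha x u).2 e
      simpa [h1, h2] using e
    · intro u v huv
      by_cases hs : (u, v) = t
      · have : Function.update id a y u = Function.update id a y v := by
          rcases hty with rfl | rfl <;> cases hs <;> simp [hya]
        rw [this]
        exact .refl _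
      · exact .glue (Finset.mem_image.2 ⟨(u, v), Finset.mem_erase.2 ⟨hs, huv⟩, rfl⟩)

/-- Contracting a set of isolated vertices, each of which is glued to a vertex that is kept. -/
theorem contract_finset (N : Finset V) : ∀ (L : Finset (V × V)),
    (∀ a ∈ N, ∀ x v, ¬ Adj a x v ∧ ¬ Adj v x a) →
    (∀ a ∈ N, ∃ u, u ∉ N ∧ FoldG Adj (fun u v => (u, v) ∈ L) a u) →
    ∃ L' : Finset (V × V), L'.card + N.card ≤ L.card ∧
      (∀ p ∈ L', FoldG Adj (fun u v => (u, v) ∈ L) p.1 p.2) ∧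
      (∀ Q : V → Prop, (∀ p ∈ L, Q p.1 ∧ Q p.2) →
        ∀ p ∈ L', (Q p.1 ∧ p.1 ∉ N) ∧ (Q p.2 ∧ p.2 ∉ N)) ∧
      ∀ u v, u ∉ N → v ∉ N → FoldG Adj (fun u v => (u, v) ∈ L) u v →
        FoldG Adj (fun u v => (u, v) ∈ L') u v := by
  classical
  induction N using Finset.induction_on with
  | empty =>
    intro L _ _
    exact ⟨L, by simp, fun p hp => .glue hp, fun Q hQ p hp => by simpa using hQ p hp,
      fun u v _ _ h => h⟩
  | insert a N haN ih =>
    intro L hiso hglue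
    obtain ⟨u, hu, hau⟩ := hglue a (Finset.mem_insert_self _ _)
    have hua : u ≠ a := fun h => hu (h ▸ Finset.mem_insert_self _ _)
    obtain ⟨y, hya, hay, hyL, L1, hcard, hL1, hR⟩ :=
      contract (hiso a (Finset.mem_insert_self _ _)) hua hau
    have hR' : ∀ u v, u ≠ a → v ≠ a → FoldG Adj (fun u v => (u, v) ∈ L) u v →
        FoldG Adj (fun u v => (u, v) ∈ L1) u v := fun u v hu hv h => by
      simpa [hu, hv] using hR u v h
    have hρ : ∀ w, FoldG Adj (fun u v => (u, v) ∈ L) (Function.update id a y w) w := by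
      intro w
      by_cases hw : w = a
      · subst hw; simpa using hay.symm
      · simpa [hw] using FoldG.refl w
    have hL1R : ∀ p ∈ L1, FoldG Adj (fun u v => (u, v) ∈ L) p.1 p.2 := by
      intro p hp
      obtain ⟨t, ht, rfl⟩ := hL1 p hp
      exact (hρ _).trans (.trans (.glue ht) (hρ _).symm)
    obtain ⟨L', hc', hL', hQ', hR''⟩ := ih L1
      (fun a' ha' => hiso a' (Finset.mem_insert_of_mem ha')) (fun a' ha' => by
        obtain ⟨u', hu', h⟩ := hglue a' (Finset.mem_insert_of_mem ha')
        rw [Finset.mem_insert, not_or] at hu'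
        exact ⟨u', hu'.2, hR' _ _ (fun e => haN (e ▸ ha')) hu'.1 h⟩)
    refine ⟨L', ?_, ?_, ?_, ?_⟩
    · rw [Finset.card_insert_of_notMem haN]; omega
    · exact fun p hp => (hL' p hp).bind fun u v h => hL1R _ h
    · intro Q hQ
      have hy : Q y := by
        rcases hyL with h | h
        · exact (hQ _ h).2
        · exact (hQ _ h).1
      have hup : ∀ w, Q w → Q (Function.update id a y w) ∧ Function.update id a y w ≠ a := by
        intro w hw
        by_cases h : w = a
        · subst h; simpa using ⟨hy, hya⟩
        · simpa [h] using hw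
      intro p hp
      have := hQ' (fun w => Q w ∧ w ≠ a) (fun p hp => by
        obtain ⟨t, ht, rfl⟩ := hL1 p hp
        exact ⟨hup _ (hQ t ht).1, hup _ (hQ t ht).2⟩) p hp
      simp only [Finset.mem_insert, not_or]
      tauto
    · intro u v hu hv h
      rw [Finset.mem_insert, not_or] at hu hv
      exact hR'' u v hu.2 hv.2 (hR' u v hu.1 hv.1 h)

-- Here `a` is identified with `p` before the edge `a → c` is used. Contracting `a` saves one pair;
-- `c`, which the fold would then identify with `q`, is renamed `q` in the remaining pairs, at no
-- further cost.
open Classical in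
theorem remove_edge_of_tail {L : Finset (V × V)} {a c p q : V} {x : B} (hac : a ≠ c)
    (ha : ∀ x v, ¬ Adj a x v ∧ ¬ Adj v x a) (hc : ∀ x v, ¬ Adj c x v ∧ ¬ Adj v x c)
    (hpq : Adj p x q) (h : FoldG Adj (fun u v => (u, v) ∈ L) a p) :
    ∃ L' : Finset (V × V), L'.card + 1 ≤ L.card ∧
      (∀ t ∈ L', FoldG (fun u y v => Adj u y v ∨ (u = a ∧ y = x ∧ v = c))
        (fun u v => (u, v) ∈ L) t.1 t.2) ∧
      (∀ Q : V → Prop, (∀ t ∈ L, Q t.1 ∧ Q t.2) → (∀ u x v, Adj u x v → Q u ∧ Q v) →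
        ∀ t ∈ L', (Q t.1 ∧ t.1 ≠ a ∧ t.1 ≠ c) ∧ (Q t.2 ∧ t.2 ≠ a ∧ t.2 ≠ c)) ∧
      ∀ u v, u ≠ a → u ≠ c → v ≠ a → v ≠ c →
        FoldG (fun u y v => Adj u y v ∨ (u = a ∧ y = x ∧ v = c)) (fun u v => (u, v) ∈ L) u v →
        FoldG Adj (fun u v => (u, v) ∈ L') u v := by
  have hadj : ∀ u y v, Adj u y v → (u ≠ a ∧ u ≠ c) ∧ (v ≠ a ∧ v ≠ c) := by
    intro u y v e
    refine ⟨⟨?_, ?_⟩, ?_, ?_⟩ <;> rintro rfl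
    · exact (ha _ _).1 e
    · exact (hc _ _).1 e
    · exact (ha _ _).2 e
    · exact (hc _ _).2 e
  obtain ⟨⟨hpa, hpc⟩, hqa, hqc⟩ := hadj _ _ _ hpq
  obtain ⟨y, hya, hay, hyL, L1, hcard, hL1, hR⟩ := contract ha hpa h
  let ρ : V → V := Function.update id a y
  let σ : V → V := Function.update id c q
  -- `ρ'` retracts the extra edge onto `p → q`. It need not equal the renaming `σ ∘ ρ` applied to
  -- the pairs, but the two agree up to the fold closure of `L2` (`hρ'`).
  let ρ' : V → V := fun w => if w = a then p else if w = c then q else w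
  let L2 := L1.image (fun t => (σ t.1, σ t.2))
  have hσ : ∀ u v, FoldG Adj (fun u v => (u, v) ∈ L1) u v →
      FoldG Adj (fun u v => (u, v) ∈ L2) (σ u) (σ v) := by
    intro u v h
    refine h.map σ ?_ (fun u v h => .glue (Finset.mem_image.2 ⟨_, h, rfl⟩))
    intro u y v e
    simpa [σ, (hadj _ _ _ e).1.2, (hadj _ _ _ e).2.2] using e
  have hyp : FoldG Adj (fun u v => (u, v) ∈ L2) (σ y) p := by
    have := hσ _ _ (hR _ _ h)
    simpa [σ, hpa, hpc] using this
  have hρ' : ∀ w, FoldG Adj (fun u v => (u, v) ∈ L2) (σ (ρ w)) (ρ' w) := by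
    intro w
    by_cases h1 : w = a
    · subst h1; simpa [ρ, ρ'] using hyp
    · by_cases h2 : w = c
      · subst h2; simpa [ρ, ρ', σ, h1] using FoldG.refl _
      · simpa [ρ, ρ', σ, h1, h2] using FoldG.refl _
  have hsub : ∀ u v, FoldG Adj (fun u v => (u, v) ∈ L) u v →
      FoldG (fun u y v => Adj u y v ∨ (u = a ∧ y = x ∧ v = c)) (fun u v => (u, v) ∈ L) u v :=
    fun u v h => h.map id (fun _ _ _ => .inl) (fun _ _ => .glue)
  have hcq : FoldG (fun u y v => Adj u y v ∨ (u = a ∧ y = x ∧ v = c))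
      (fun u v => (u, v) ∈ L) c q := .foldHeads (.inr ⟨rfl, rfl, rfl⟩) (.inl hpq) (hsub _ _ h)
  have hback : ∀ w, FoldG (fun u y v => Adj u y v ∨ (u = a ∧ y = x ∧ v = c))
      (fun u v => (u, v) ∈ L) (σ (ρ w)) w := by
    have h1 : ∀ w, FoldG (fun u y v => Adj u y v ∨ (u = a ∧ y = x ∧ v = c))
      (fun u v => (u, v) ∈ L) (σ w) w := by
      intro w
      by_cases h : w = c
      · subst h; simpa [σ] using hcq.symm
      · simpa [σ, h] using FoldG.refl _
    intro w
    refine (h1 _).trans ?_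
    by_cases h : w = a
    · subst h; simpa [ρ] using hsub _ _ hay.symm
    · simpa [ρ, h] using FoldG.refl _
  have hL2 : ∀ t ∈ L2, ∃ s ∈ L, t = (σ (ρ s.1), σ (ρ s.2)) := by
    intro t ht
    obtain ⟨r, hr, rfl⟩ := Finset.mem_image.1 ht
    obtain ⟨s, hs, rfl⟩ := hL1 r hr
    exact ⟨s, hs, rfl⟩
  refine ⟨L2, (Nat.add_le_add_right Finset.card_image_le 1).trans hcard, ?_, ?_, ?_⟩
  · intro t ht
    obtain ⟨s, hs, rfl⟩ := hL2 t ht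
    exact (hback _).trans (.trans (.glue hs) (hback _).symm)
  · intro Q hQ hQA
    have hy : Q y := by
      rcases hyL with h | h
      · exact (hQ _ h).2
      · exact (hQ _ h).1
    have hq := (hQA _ _ _ hpq).2
    have hup : ∀ w, Q w → Q (σ (ρ w)) ∧ σ (ρ w) ≠ a ∧ σ (ρ w) ≠ c := by
      intro w hw
      have h1 : Q (ρ w) ∧ ρ w ≠ a := by
        by_cases h : w = a
        · subst h; simpa [ρ] using ⟨hy, hya⟩
        · simpa [ρ, h] using hw
      by_cases h : ρ w = c
      · simpa [h, σ] using ⟨hq, hqa, hqc⟩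
      · simpa [h, σ] using h1
    intro t ht
    obtain ⟨s, hs, rfl⟩ := hL2 t ht
    exact ⟨hup _ (hQ s hs).1, hup _ (hQ s hs).2⟩
  · intro u v hua huc hva hvc h
    have := h.map (Adj' := Adj) (P' := fun u v => (u, v) ∈ L2) ρ' ?_ ?_
    · simpa [ρ', hua, huc, hva, hvc] using this
    · rintro u y v (e | ⟨rfl, rfl, rfl⟩)
      · obtain ⟨⟨h1, h2⟩, h3, h4⟩ := hadj _ _ _ e
        simpa [ρ', h1, h2, h3, h4] using e
      · simpa [ρ', hac.symm] using hpq
    · intro u v huv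
      exact (hρ' u).symm.trans ((hσ _ _ (hR _ _ (.glue huv))).trans (hρ' v))

/-- An isolated edge `a → c` that gets folded onto another edge can be removed, together with one
pair of the gluing. -/
theorem remove_edge {L : Finset (V × V)} {a c p q : V} {x : B} (hac : a ≠ c)
    (ha : ∀ x v, ¬ Adj a x v ∧ ¬ Adj v x a) (hc : ∀ x v, ¬ Adj c x v ∧ ¬ Adj v x c)
    (hpq : Adj p x q) (h : FoldG (fun u y v => Adj u y v ∨ (u = a ∧ y = x ∧ v = c))
        (fun u v => (u, v) ∈ L) a p) :
    ∃ L' : Finset (V × V), L'.card + 1 ≤ L.card ∧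
      (∀ t ∈ L', FoldG (fun u y v => Adj u y v ∨ (u = a ∧ y = x ∧ v = c))
        (fun u v => (u, v) ∈ L) t.1 t.2) ∧
      (∀ Q : V → Prop, (∀ t ∈ L, Q t.1 ∧ Q t.2) → (∀ u x v, Adj u x v → Q u ∧ Q v) →
        ∀ t ∈ L', (Q t.1 ∧ t.1 ≠ a ∧ t.1 ≠ c) ∧ (Q t.2 ∧ t.2 ≠ a ∧ t.2 ≠ c)) ∧
      ∀ u v, u ≠ a → u ≠ c → v ≠ a → v ≠ c →
        FoldG (fun u y v => Adj u y v ∨ (u = a ∧ y = x ∧ v = c)) (fun u v => (u, v) ∈ L) u v →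
        FoldG Adj (fun u v => (u, v) ∈ L') u v := by
  -- Look at the first fold between the extra edge and another edge: the tails or the heads were
  -- identified earlier, without the extra edge. If there were no such fold, the closure without the
  -- extra edge would already be closed under its folds, so that `a` could not meet `p`.
  obtain ⟨p', q', e, h' | h'⟩ : ∃ p' q', Adj p' x q' ∧
      (FoldG Adj (fun u v => (u, v) ∈ L) a p' ∨ FoldG Adj (fun u v => (u, v) ∈ L) c q') := by
    by_contra! hcon
    refine (hcon p q hpq).1 (h.le equivalence (fun _ _ => .glue) ?_ ?_)
    · rintro u u' y v v' (e | ⟨rfl, rfl, rfl⟩) (e' | ⟨rfl, hy, rfl⟩) h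
      · exact .foldHeads e e' h
      · exact absurd h.symm (hcon _ _ (hy ▸ e)).1
      · exact absurd h (hcon _ _ e').1
      · exact .refl _
    · rintro u u' y v v' (e | ⟨rfl, rfl, rfl⟩) (e' | ⟨rfl, hy, rfl⟩) h
      · exact .foldTails e e' h
      · exact absurd h.symm (hcon _ _ (hy ▸ e)).2
      · exact absurd h (hcon _ _ e').2
      · exact .refl _
  · exact remove_edge_of_tail hac ha hc e h'
  · have hfl : ∀ {u v}, FoldG (fun u y v => Adj v y u ∨ (u = c ∧ y = x ∧ v = a))
        (fun u v => (u, v) ∈ L) u v ↔ FoldG (fun u y v => Adj u y v ∨ (u = a ∧ y = x ∧ v = c))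
        (fun u v => (u, v) ∈ L) u v := fun {u v} =>
      ⟨fun h => h.flip.map id (fun u y v => by tauto) (fun _ _ => .glue),
        fun h => h.flip.map id (fun u y v => by tauto) (fun _ _ => .glue)⟩
    obtain ⟨L', h1, h2, h3, h4⟩ := remove_edge_of_tail (Adj := fun u y v => Adj v y u) hac.symm
      (fun x v => (hc x v).symm) (fun x v => (ha x v).symm) e h'.flip
    refine ⟨L', h1, fun t ht => hfl.1 (h2 t ht), fun Q hQ hA t ht => ?_, ?_⟩
    · have := h3 Q hQ (fun u x v e => (hA _ _ _ e).symm) t ht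
      tauto
    · intro u v hua huc hva hvc h
      exact (h4 u v huc hua hvc hva (hfl.2 h)).flip

end FoldG

/-! ### Chains of immediate morphisms as sets of labeled triples -/

section Triples

variable {I F : Type*} [Group F]

/-- The labeled relation formed by the loops at `i` with labels in `H i` and by the triples in `T`. -/
def loopRel (H : I → Subgroup F) (T : Finset (I × F × I)) : I → F → I → Prop :=
  fun u g v => (u = v ∧ g ∈ H u) ∨ (u, g, v) ∈ T

/-- The subgroups `H i`, `i ∈ S`, together with the triples in `T` generate the full groupoid with
vertex set `S` and vertex group `J`. -/
def Full (J : Subgroup F) (S : Finset I) (H : I → Subgroup F) (T : Finset (I × F × I)) : Prop :=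
  (∀ t ∈ T, t.1 ∈ S ∧ t.2.2 ∈ S ∧ t.2.1 ∈ J) ∧
    ∀ i ∈ S, ∀ k ∈ S, ∀ j ∈ J, GPath (loopRel H T) i k j

theorem mem_conjSubgroup {g x : F} {H : Subgroup F} :
    x ∈ conjSubgroup g H ↔ ∃ h ∈ H, g * h * g⁻¹ = x := Iff.rfl

theorem conjSubgroup_le {J H : Subgroup F} {g : F} (hg : g ∈ J) (hH : H ≤ J) :
    conjSubgroup g H ≤ J := by
  rintro _ ⟨h, hh, rfl⟩
  exact J.mul_mem (J.mul_mem hg (hH hh)) (J.inv_mem hg)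

variable [DecidableEq I]

theorem map_val_update {α : Type*} {S : Finset I} {i : I} (hi : i ∈ S) (H : I → α) (A : α) :
    S.val.map (Function.update H i A) = A ::ₘ (S.erase i).val.map H := by
  refine (Multiset.map_eq_cons _ _ _ _).1 ⟨i, hi, by simp, ?_⟩
  rw [← Finset.erase_val]
  refine Multiset.map_congr rfl fun k hk => ?_
  rw [Function.update_of_ne (Finset.ne_of_mem_erase hk)]

theorem map_val_eq_cons {α : Type*} {S : Finset I} {H : I → α} {A : α} {s : Multiset α}
    (h : S.val.map H = A ::ₘ s) : ∃ i ∈ S, H i = A ∧ (S.erase i).val.map H = s := by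
  obtain ⟨i, hi, h1, h2⟩ := (Multiset.map_eq_cons _ _ _ _).2 h
  exact ⟨i, hi, h1, by rwa [Finset.erase_val]⟩

theorem map_val_erase {α : Type*} {S : Finset I} {i : I} (hi : i ∈ S) (H : I → α) :
    S.val.map H = H i ::ₘ (S.erase i).val.map H := by
  conv_lhs => rw [← Function.update_eq_self i H]
  exact map_val_update hi H _

theorem gpath_update {H : I → Subgroup F} {T : Finset (I × F × I)} {R : I → F → I → Prop}
    {i : I} {A : Subgroup F} (hA : A ≤ vertexGroup R i)
    (hH : ∀ k, k ≠ i → H k ≤ vertexGroup R k) (hT : ∀ u g v, (u, g, v) ∈ T → GPath R u v g)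
    {u v : I} {g : F} (h : GPath (loopRel (Function.update H i A) T) u v g) : GPath R u v g := by
  refine h.bind ?_
  rintro u g v (⟨rfl, hg⟩ | hg)
  · by_cases hu : u = i
    · subst hu
      rw [Function.update_self] at hg
      exact hA hg
    · rw [Function.update_of_ne hu] at hg
      exact hH u hu hg
  · exact hT _ _ _ hg

-- One triple per immediate morphism: adjoining `j` at the index `i` is the loop `(i, j, i)`. A
-- merge is the triple `(k, j, i)`, along which `H i` is conjugated into the vertex group at `k`;
-- the index `i` then disappears from the later stages.
open Classical in
theorem ImmediateChain.exists_full {J : Subgroup F} {n : ℕ} {s t : Multiset (Subgroup F)}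
    (h : ImmediateChain J n s t) : t = {J} → ∀ (S : Finset I) (H : I → Subgroup F),
      S.val.map H = s → ∃ T : Finset (I × F × I), T.card ≤ n ∧ Full J S H T := by
  induction h with
  | nil s =>
    rintro rfl S H hS
    obtain ⟨a, ha, rfl⟩ := Multiset.map_eq_singleton.1 hS
    have hS' : ∀ i ∈ S, i = a := fun i hi => by
      have : i ∈ S.val := hi
      rw [ha] at this
      simpa using this
    refine ⟨∅, by simp, by simp, fun i hi k hk j hj => ?_⟩
    rw [hS' i hi, hS' k hk]
    exact .single (.inl ⟨rfl, hj⟩)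
  | @cons n s t r himm _ ih =>
    intro hr S H hS
    cases himm with
    | adjoin s A j hj =>
      obtain ⟨i, hi, rfl, rfl⟩ := map_val_eq_cons hS
      obtain ⟨T, hT, hT1, hT2⟩ := ih hr S _ (map_val_update hi H _)
      refine ⟨insert (i, j, i) T, (Finset.card_insert_le _ _).trans (by omega), ?_, ?_⟩
      · intro t ht
        rcases Finset.mem_insert.1 ht with rfl | ht
        · exact ⟨hi, hi, hj⟩
        · exact hT1 t ht
      · intro u hu v hv g hg
        refine gpath_update ?_ ?_ ?_ (hT2 u hu v hv g hg)
        · refine sup_le (fun h hh => .single (.inl ⟨rfl, hh⟩)) ?_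
          rw [Subgroup.zpowers_le]
          exact .single (.inr (Finset.mem_insert_self _ _))
        · exact fun k _ h hh => .single (.inl ⟨rfl, hh⟩)
        · exact fun u g v h => .single (.inr (Finset.mem_insert_of_mem h))
    | merge s A K j hj =>
      obtain ⟨i, hi, rfl, h2⟩ := map_val_eq_cons hS
      obtain ⟨k, hk, rfl, rfl⟩ := map_val_eq_cons h2
      obtain ⟨hki, hkS⟩ := Finset.mem_erase.1 hk
      obtain ⟨T, hT, hT1, hT2⟩ := ih hr (S.erase i) _ (map_val_update hk H _)
      have hki' : GPath (loopRel H (insert (k, j, i) T)) k i j :=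
        .single (.inr (Finset.mem_insert_self _ _))
      have hful : ∀ u ∈ S.erase i, ∀ v ∈ S.erase i, ∀ g ∈ J,
          GPath (loopRel H (insert (k, j, i) T)) u v g := by
        intro u hu v hv g hg
        refine gpath_update ?_ ?_ ?_ (hT2 u hu v hv g hg)
        · refine sup_le ?_ (fun h hh => .single (.inl ⟨rfl, hh⟩))
          rintro _ ⟨h, hh, rfl⟩
          exact (hki'.mul (.single (.inl ⟨rfl, hh⟩))).mul hki'.inv
        · exact fun k _ h hh => .single (.inl ⟨rfl, hh⟩)
        · exact fun u g v h => .single (.inr (Finset.mem_insert_of_mem h))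
      refine ⟨insert (k, j, i) T, (Finset.card_insert_le _ _).trans (by omega), ?_, ?_⟩
      · intro t ht
        rcases Finset.mem_insert.1 ht with rfl | ht
        · exact ⟨hkS, hi, hj⟩
        · exact ⟨Finset.mem_of_mem_erase (hT1 t ht).1, Finset.mem_of_mem_erase (hT1 t ht).2.1,
            (hT1 t ht).2.2⟩
      · have hcon : ∀ u ∈ S, ∃ v ∈ S.erase i, ∃ h ∈ J,
            GPath (loopRel H (insert (k, j, i) T)) u v h := by
          intro u hu
          by_cases h : u = i
          · subst h
            exact ⟨k, hk, j⁻¹, J.inv_mem hj, hki'.inv⟩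
          · exact ⟨u, Finset.mem_erase.2 ⟨h, hu⟩, 1, J.one_mem, .nil u⟩
        intro u hu v hv g hg
        obtain ⟨u', hu', h, hh, hp⟩ := hcon u hu
        obtain ⟨v', hv', h', hh', hp'⟩ := hcon v hv
        exact ((hp.mul (hful u' hu' v' hv' (h⁻¹ * g * h')
          (J.mul_mem (J.mul_mem (J.inv_mem hh) hg) hh'))).mul hp'.inv).cast (by group)

-- The triples are consumed one at a time: a loop is an `adjoin`, and a triple between distinct
-- indices is contracted by a `merge`. Without triples no path leaves its vertex, so only one index
-- is left and its group is `J`. The length is only bounded by `n`, because triples may coincide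
-- after a contraction.
open Classical in
theorem Full.exists_immediateChain {J : Subgroup F} (n : ℕ) : ∀ (S : Finset I)
    (H : I → Subgroup F) (T : Finset (I × F × I)), T.card ≤ n → S.Nonempty →
    (∀ i ∈ S, H i ≤ J) → Full J S H T → ∃ m ≤ n, ImmediateChain J m (S.val.map H) {J} := by
  induction n with
  | zero =>
    rintro S H T hT ⟨i, hi⟩ hH ⟨-, hful⟩
    obtain rfl : T = ∅ := Finset.card_eq_zero.1 (Nat.le_zero.1 hT)
    have hpath : ∀ {u v g}, GPath (loopRel H ∅) u v g → u = v ∧ g ∈ H u := by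
      intro u v g h
      induction h with
      | nil p => exact ⟨rfl, (H p).one_mem⟩
      | fwd e _ ih =>
        rcases e with ⟨rfl, hg⟩ | e
        · exact ⟨ih.1, (H _).mul_mem hg ih.2⟩
        · simp at e
      | bwd e _ ih =>
        rcases e with ⟨rfl, hg⟩ | e
        · exact ⟨ih.1, (H _).mul_mem ((H _).inv_mem hg) ih.2⟩
        · simp at e
    obtain rfl : S = {i} := Finset.eq_singleton_iff_unique_mem.2
      ⟨hi, fun k hk => (hpath (hful k hk i hi 1 J.one_mem)).1⟩
    have hJ : H i = J := le_antisymm (hH i hi) fun j hj => (hpath (hful i hi i hi j hj)).2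
    refine ⟨0, le_rfl, ?_⟩
    simpa [hJ] using ImmediateChain.nil (J := J) {J}
  | succ n ih =>
    intro S H T hT hS hH hful
    rcases T.eq_empty_or_nonempty with rfl | ⟨⟨i, j, k⟩, ht⟩
    · obtain ⟨m, hm, hc⟩ := ih S H ∅ (by simp) hS hH hful
      exact ⟨m, hm.trans (Nat.le_succ n), hc⟩
    obtain ⟨hTS, hful⟩ := hful
    obtain ⟨hi, hk, hj⟩ := hTS _ ht
    have hcard : (T.erase (i, j, k)).card ≤ n := by
      rw [Finset.card_erase_of_mem ht]; omega
    by_cases hik : i = k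
    · subst hik
      have hle : ∀ u, H u ≤ Function.update H i (H i ⊔ Subgroup.zpowers j) u := by
        intro u
        by_cases hu : u = i
        · subst hu; simp
        · simp [hu]
      obtain ⟨m, hm, hc⟩ := ih S (Function.update H i (H i ⊔ Subgroup.zpowers j))
        (T.erase (i, j, i)) hcard hS (fun u hu => by
          by_cases hui : u = i
          · subst hui
            simpa using ⟨hH u hu, hj⟩
          · simpa [hui] using hH u hu)
        ⟨fun t ht => hTS t (Finset.mem_of_mem_erase ht), fun u hu v hv g hg => by
          refine (hful u hu v hv g hg).mono ?_
          rintro u g v (⟨rfl, hg⟩ | hg)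
          · exact .inl ⟨rfl, hle u hg⟩
          · by_cases he : (u, g, v) = (i, j, i)
            · cases he
              refine .inl ⟨rfl, ?_⟩
              rw [Function.update_self]
              exact (le_sup_right : _ ≤ H i ⊔ Subgroup.zpowers j) (Subgroup.mem_zpowers j)
            · exact .inr (Finset.mem_erase.2 ⟨he, hg⟩)⟩
      rw [map_val_update hi] at hc
      rw [map_val_erase hi]
      exact ⟨m + 1, Nat.succ_le_succ hm, .cons (.adjoin _ _ _ hj) hc⟩
    · let f : I → I := fun u => if u = i then k else u
      let φ : I → F := fun u => if u = i then j⁻¹ else 1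
      have hki : k ≠ i := fun h => hik h.symm
      have hkS : k ∈ S.erase i := Finset.mem_erase.2 ⟨hki, hk⟩
      have hφ : ∀ u, φ u ∈ J := fun u => by
        by_cases h : u = i
        · simpa [φ, h] using hj
        · simp [φ, h]
      have hf : ∀ u ∈ S, f u ∈ S.erase i := fun u hu => by
        by_cases h : u = i
        · simpa [f, h] using ⟨hki, hk⟩
        · simpa [f, h] using hu
      let H' := Function.update H k (conjSubgroup j⁻¹ (H i) ⊔ H k)
      let T' := (T.erase (i, j, k)).image fun t => (f t.1, φ t.1 * t.2.1 * (φ t.2.2)⁻¹, f t.2.2)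
      have hloop : ∀ u, ∀ g ∈ H u, φ u * g * (φ u)⁻¹ ∈ H' (f u) := by
        intro u g hg
        by_cases hui : u = i
        · subst hui
          simp only [f, φ, H', if_true, Function.update_self]
          exact (le_sup_left : _ ≤ conjSubgroup j⁻¹ (H u) ⊔ H k) ⟨g, hg, rfl⟩
        · simp only [f, φ, H', if_neg hui, one_mul, inv_one, mul_one]
          by_cases huk : u = k
          · subst huk
            rw [Function.update_self]
            exact (le_sup_right : _ ≤ conjSubgroup j⁻¹ (H i) ⊔ H u) hg
          · rwa [Function.update_of_ne huk]
      obtain ⟨m, hm, hc⟩ := ih (S.erase i) H' T' (Finset.card_image_le.trans hcard) ⟨k, hkS⟩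
        (fun u hu => by
          by_cases huk : u = k
          · subst huk
            simp only [H', Function.update_self]
            exact sup_le (conjSubgroup_le (J.inv_mem hj) (hH i hi)) (hH u hk)
          · simpa [H', huk] using hH u (Finset.mem_of_mem_erase hu))
        ⟨fun t ht => by
          obtain ⟨s, hs, rfl⟩ := Finset.mem_image.1 ht
          obtain ⟨h1, h2, h3⟩ := hTS s (Finset.mem_of_mem_erase hs)
          exact ⟨hf _ h1, hf _ h2, J.mul_mem (J.mul_mem (hφ _) h3) (J.inv_mem (hφ _))⟩,
        fun u hu v hv g hg => by
          have hui := Finset.ne_of_mem_erase hu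
          have hvi := Finset.ne_of_mem_erase hv
          have := (hful u (Finset.mem_of_mem_erase hu) v (Finset.mem_of_mem_erase hv) g hg).gauge
            (S' := loopRel H' T') f φ ?_
          · simpa [f, φ, hui, hvi] using this
          · rintro u g v (⟨rfl, hg⟩ | hg)
            · exact .single (.inl ⟨rfl, hloop u g hg⟩)
            · by_cases he : (u, g, v) = (i, j, k)
              · cases he
                simp [f, φ, hki, GPath.nil]
              · exact .single (.inr (Finset.mem_image.2 ⟨_, Finset.mem_erase.2 ⟨he, hg⟩, rfl⟩))⟩
      rw [map_val_update hkS] at hc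
      rw [map_val_erase hi, map_val_erase hkS]
      exact ⟨m + 1, Nat.succ_le_succ hm, .cons (.merge _ _ _ _ (J.inv_mem hj)) hc⟩

end Triples

/-! ### Triples on the vertices of Γ versus triples on its components -/

section Generation

variable {B F : Type*} [Group F] (b : FreeGroupBasis B F) {Γ Δ : MultiCoreGraph B} (η : Hom Γ Δ)

/-- The edges of `Γ`, labeled by basis elements, together with the triples in `T`. -/
def genRel (Γ : MultiCoreGraph B) (T : Finset (Γ.V × F × Γ.V)) : Γ.V → F → Γ.V → Prop :=
  fun u g v => lab b Γ.Adj u g v ∨ (u, g, v) ∈ T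

/-- The triples in `T` extend the fundamental groupoid of `Γ` to the groupoid induced from `Δ`. -/
def Gen (T : Finset (Γ.V × F × Γ.V)) : Prop :=
  (∀ t ∈ T, PathLabel b Δ (η.toFun t.1) (η.toFun t.2.2) t.2.1) ∧
    ∀ a c g, PathLabel b Δ (η.toFun a) (η.toFun c) g → GPath (genRel b Γ T) a c g

variable {b η}

theorem PathLabel.cast {p q : Γ.V} {g g' : F} (h : PathLabel b Γ p q g) (e : g = g') :
    PathLabel b Γ p q g' := e ▸ h

theorem PathLabel.gpath {T : Finset (Γ.V × F × Γ.V)} {p q : Γ.V} {g : F}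
    (h : PathLabel b Γ p q g) : GPath (genRel b Γ T) p q g :=
  (pathLabel_iff.1 h).mono fun _ _ _ => .inl

-- Collapse every component of Γ over `C` to one index, using the gauge that labels a path in Δ from
-- the base vertex of `C` to the image of the given vertex. Edges of Γ become loops with labels in
-- `fiberGroup`. Only the triples over `C` are needed, since no path of `genRel` leaves the vertices
-- over `C`.
open Classical in
theorem Gen.exists_full {T : Finset (Γ.V × F × Γ.V)} (hT : Gen b η T) {C : Δ.Component}
    (hC : ∃ D, η.mapComp D = C) :
    ∃ T' : Finset ({D // η.mapComp D = C} × F × {D // η.mapComp D = C}),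
      T'.card ≤ (T.filter fun t => Δ.comp (η.toFun t.1) = C).card ∧
      ∀ S : Finset {D // η.mapComp D = C}, (∀ D, D ∈ S) →
        Full (targetGroup b Δ C) S (fiberGroup b η C) T' := by
  obtain ⟨D0, hD0⟩ := hC
  -- `D0` is a default value at vertices that are not over `C`; the transported paths never visit
  -- them.
  let f : Γ.V → {D // η.mapComp D = C} := fun a =>
    if h : η.mapComp (Γ.comp a) = C then ⟨Γ.comp a, h⟩ else ⟨D0, hD0⟩
  have hf : ∀ a (h : Δ.comp (η.toFun a) = C), f a = ⟨Γ.comp a, h⟩ := fun a h => dif_pos h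
  have hr : ∀ a, ∃ r, Δ.comp (η.toFun a) = C → PathLabel b Γ a (Γ.base (f a).1) r := by
    intro a
    by_cases h : Δ.comp (η.toFun a) = C
    · obtain ⟨r, hr⟩ := exists_pathLabel b (p := a) (q := Γ.base (f a).1)
        (by rw [comp_base, hf a h])
      exact ⟨r, fun _ => hr⟩
    · exact ⟨1, fun h' => absurd h' h⟩
  choose r hr using hr
  let φ : Γ.V → F := fun a => connector b η C (f a) * (r a)⁻¹
  have hφ : ∀ a, Δ.comp (η.toFun a) = C → PathLabel b Δ (Δ.base C) (η.toFun a) (φ a) :=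
    fun a h => (connector_spec b η C (f a)).mul ((hr a h).map η).inv
  refine ⟨(T.filter fun t => Δ.comp (η.toFun t.1) = C).image
    fun t => (f t.1, φ t.1 * t.2.1 * (φ t.2.2)⁻¹, f t.2.2), Finset.card_image_le, ?_⟩
  refine fun S hS => ⟨?_, ?_⟩
  · intro t ht
    obtain ⟨s, hs, rfl⟩ := Finset.mem_image.1 ht
    obtain ⟨hs, hsC⟩ := Finset.mem_filter.1 hs
    have h := hT.1 s hs
    exact ⟨hS _, hS _, ((hφ _ hsC).mul h).mul (hφ _ (h.comp_eq.symm.trans hsC)).inv⟩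
  · intro i _ k _ j hj
    have hi : Δ.comp (η.toFun (Γ.base i.1)) = C := by
      rw [← Hom.mapComp_comp, comp_base, i.2]
    have hk : Δ.comp (η.toFun (Γ.base k.1)) = C := by
      rw [← Hom.mapComp_comp, comp_base, k.2]
    have hfi : f (Γ.base i.1) = i := by rw [hf _ hi]; exact Subtype.ext (comp_base _ _)
    have hfk : f (Γ.base k.1) = k := by rw [hf _ hk]; exact Subtype.ext (comp_base _ _)
    have hj' : PathLabel b Δ (Δ.base C) (Δ.base C) j := hj
    have hp := hT.2 _ _ _ (((hφ _ hi).inv.mul hj').mul (hφ _ hk))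
    have := hp.gaugeOn (S' := loopRel (fiberGroup b η C) ((T.filter fun t =>
      Δ.comp (η.toFun t.1) = C).image fun t => (f t.1, φ t.1 * t.2.1 * (φ t.2.2)⁻¹, f t.2.2)))
      (fun a => Δ.comp (η.toFun a) = C) f φ ?_ ?_ hi
    · rw [hfi, hfk] at this
      exact this.cast (by group)
    · rintro p g q (⟨x, e, rfl⟩ | e)
      · rw [comp_eq_of_adj (η.map_adj e)]
      · rw [(hT.1 _ e).comp_eq]
    · rintro p g q hp hq (⟨x, e, rfl⟩ | e)
      · have hpq : f p = f q := by
          rw [hf p hp, hf q hq]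
          exact Subtype.ext (Quot.sound ⟨x, e⟩)
        refine .single (.inl ⟨hpq, ?_⟩)
        have h1 := hr p hp
        rw [hpq] at h1
        refine mem_conjSubgroup.2 ⟨(r p)⁻¹ * (b x * r q), ?_, ?_⟩
        · rw [hpq]
          exact h1.inv.mul (.fwd e (hr q hq))
        · simp only [φ, hpq]
          group
      · exact .single (.inr (Finset.mem_image.2
          ⟨_, Finset.mem_filter.2 ⟨e, hp⟩, rfl⟩))

-- The generators for the separate components of Δ are placed at the base vertices of the components
-- of Γ, the connectors undoing the conjugations. Paths inside Γ then reach all other vertices.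
open Classical in
theorem exists_gen_of_full [Fintype Δ.Component]
    (T : ∀ C : Δ.Component, Finset ({D // η.mapComp D = C} × F × {D // η.mapComp D = C}))
    (S : ∀ C : Δ.Component, Finset {D // η.mapComp D = C}) (hS : ∀ C D, D ∈ S C)
    (hT : ∀ C, (∃ D, η.mapComp D = C) →
      Full (targetGroup b Δ C) (S C) (fiberGroup b η C) (T C)) :
    ∃ T' : Finset (Γ.V × F × Γ.V), T'.card ≤ ∑ C, (T C).card ∧ Gen b η T' := by
  let T' : Finset (Γ.V × F × Γ.V) := Finset.univ.biUnion fun C => (T C).image fun t =>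
    (Γ.base t.1.1, (connector b η C t.1)⁻¹ * t.2.1 * connector b η C t.2.2, Γ.base t.2.2.1)
  refine ⟨T', Finset.card_biUnion_le.trans (Finset.sum_le_sum fun C _ => Finset.card_image_le),
    ?_, ?_⟩
  · intro t ht
    obtain ⟨C, -, ht⟩ := Finset.mem_biUnion.1 ht
    obtain ⟨s, hs, rfl⟩ := Finset.mem_image.1 ht
    have hj : PathLabel b Δ (Δ.base C) (Δ.base C) s.2.1 := ((hT C ⟨_, s.1.2⟩).1 s hs).2.2
    exact ((connector_spec b η C s.1).inv.mul hj).mul (connector_spec b η C s.2.2)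
  · intro a c g hg
    let C := Δ.comp (η.toFun a)
    let i : {D // η.mapComp D = C} := ⟨Γ.comp a, rfl⟩
    let k : {D // η.mapComp D = C} := ⟨Γ.comp c, hg.comp_eq.symm⟩
    obtain ⟨r, hr⟩ := exists_pathLabel b (p := a) (q := Γ.base i.1) (by rw [comp_base])
    obtain ⟨s, hs⟩ := exists_pathLabel b (p := c) (q := Γ.base k.1) (by rw [comp_base])
    have hj : PathLabel b Δ (Δ.base C) (Δ.base C)
        (connector b η C i * (r⁻¹ * g * s) * (connector b η C k)⁻¹) :=
      ((connector_spec b η C i).mul (((hr.map η).inv.mul hg).mul (hs.map η))).mul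
        (connector_spec b η C k).inv
    have hp := (hT C ⟨_, i.2⟩).2 i (hS C i) k (hS C k) _ hj
    have := hp.gauge (S' := genRel b Γ T') (fun D => Γ.base D.1)
      (fun D => (connector b η C D)⁻¹) ?_
    · exact ((hr.gpath.mul this).mul hs.inv.gpath).cast (by group)
    · rintro u g v (⟨rfl, hg⟩ | hg)
      · obtain ⟨h, hh, rfl⟩ := mem_conjSubgroup.1 hg
        exact (PathLabel.gpath hh).cast (by group)
      · refine .single (.inr (Finset.mem_biUnion.2 ⟨C, Finset.mem_univ _,
          Finset.mem_image.2 ⟨_, hg, ?_⟩⟩))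
        simp

end Generation

/-! ### Vertices and edges outside the image: the upper bound -/

section Outside

variable {B : Type*} {Γ Δ : MultiCoreGraph B} (η : Hom Γ Δ)

/-- The vertices in the components of `Δ` that meet the image of `η`. -/
def Hit (p : Δ.V) : Prop := ∃ a, Δ.comp (η.toFun a) = Δ.comp p

variable {η}

theorem Hit.of_comp_eq {p q : Δ.V} (h : Hit η p) (e : Δ.comp p = Δ.comp q) : Hit η q := by
  obtain ⟨a, ha⟩ := h
  exact ⟨a, ha.trans e⟩

theorem Hit.iff_of_comp_eq {p q : Δ.V} (e : Δ.comp p = Δ.comp q) : Hit η p ↔ Hit η q :=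
  ⟨fun h => h.of_comp_eq e, fun h => h.of_comp_eq e.symm⟩

theorem hit_iff {p : Δ.V} : Hit η p ↔ ∃ D, η.mapComp D = Δ.comp p := by
  constructor
  · rintro ⟨a, ha⟩
    exact ⟨Γ.comp a, ha⟩
  · rintro ⟨D, hD⟩
    induction D using Quot.inductionOn with
    | h a => exact ⟨a, hD⟩

theorem hit_apply (a : Γ.V) : Hit η (η.toFun a) := ⟨a, rfl⟩

variable (η)

/-- The edge `(p, x, q)` is the image of an edge of `Γ`. -/
def InImage (p : Δ.V) (x : B) (q : Δ.V) : Prop :=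
  ∃ a c, Γ.Adj a x c ∧ η.toFun a = p ∧ η.toFun c = q

instance [Finite B] : Finite Δ.Edge :=
  inferInstanceAs (Finite {e : Δ.V × B × Δ.V // Δ.Adj e.1 e.2.1 e.2.2})

/-- The vertices outside the image of `η` in the components that meet the image. -/
noncomputable def outV : Finset Δ.V :=
  (Set.toFinite {p : Δ.V | Hit η p ∧ p ∉ Set.range η.toFun}).toFinset

/-- The edges outside the image of `η` in the components that meet the image. -/
noncomputable def outE [Finite B] : Finset Δ.Edge :=
  (Set.toFinite {e : Δ.Edge | Hit η e.1.1 ∧ ¬ InImage η e.1.1 e.1.2.1 e.1.2.2}).toFinset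

variable {η}

theorem mem_outV {p : Δ.V} : p ∈ outV η ↔ Hit η p ∧ p ∉ Set.range η.toFun := by simp [outV]

theorem mem_outE [Finite B] {e : Δ.Edge} :
    e ∈ outE η ↔ Hit η e.1.1 ∧ ¬ InImage η e.1.1 e.1.2.1 e.1.2.2 := by simp [outE]

variable {F : Type*} [Group F] {b : FreeGroupBasis B F}

theorem PathLabel.exists_crossing {A : Δ.V → Prop} {p q : Δ.V} {g : F}
    (h : PathLabel b Δ p q g) (hp : A p) (hq : ¬ A q) :
    ∃ u x w, Δ.Adj u x w ∧ Δ.comp p = Δ.comp u ∧ ((A u ∧ ¬ A w) ∨ (¬ A u ∧ A w)) := by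
  induction h with
  | nil p => exact absurd hp hq
  | @fwd p q r x g e _ ih =>
    by_cases hA : A q
    · obtain ⟨u, y, w, e', h, h'⟩ := ih hA hq
      exact ⟨u, y, w, e', (comp_eq_of_adj e).trans h, h'⟩
    · exact ⟨p, x, q, e, rfl, .inl ⟨hp, hA⟩⟩
  | @bwd p q r x g e _ ih =>
    by_cases hA : A q
    · obtain ⟨u, y, w, e', h, h'⟩ := ih hA hq
      exact ⟨u, y, w, e', (comp_eq_of_adj e).symm.trans h, h'⟩
    · exact ⟨q, x, p, e, (comp_eq_of_adj e).symm, .inr ⟨hA, hp⟩⟩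

open Classical in
/-- A forest with `k` edges outside the image of `η` that attaches `k` outside vertices to the image:
the vertex `p` is joined by a path with label `γ p` to the image of `α p`. -/
theorem exists_forest [Finite B] [Nonempty Γ.V] (b : FreeGroupBasis B F) (η : Hom Γ Δ) (k : ℕ) :
    k ≤ (outV η).card → ∃ (O : Finset Δ.V) (E : Finset Δ.Edge) (α : Δ.V → Γ.V) (γ : Δ.V → F),
      O ⊆ outV η ∧ O.card = k ∧ E ⊆ outE η ∧ E.card = k ∧
      (∀ a, η.toFun (α (η.toFun a)) = η.toFun a ∧ γ (η.toFun a) = 1) ∧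
      (∀ p ∈ O, PathLabel b Δ (η.toFun (α p)) p (γ p)) ∧
      ∀ e ∈ E, (e.1.1 ∈ Set.range η.toFun ∨ e.1.1 ∈ O) ∧
        (e.1.2.2 ∈ Set.range η.toFun ∨ e.1.2.2 ∈ O) ∧ α e.1.1 = α e.1.2.2 ∧
        γ e.1.1 * b e.1.2.1 = γ e.1.2.2 := by
  induction k with
  | zero =>
    intro _
    -- Outside the image `α` has a default value, which is overwritten when the vertex joins the
    -- forest.
    have hs : ∀ p, ∃ a, p ∈ Set.range η.toFun → η.toFun a = p := fun p => by
      by_cases h : p ∈ Set.range η.toFun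
      · exact ⟨h.choose, fun _ => h.choose_spec⟩
      · exact ⟨Classical.arbitrary _, fun h' => absurd h' h⟩
    choose α hα using hs
    exact ⟨∅, ∅, α, fun _ => 1, by simp, rfl, by simp, rfl, fun a => ⟨hα _ ⟨a, rfl⟩, rfl⟩,
      by simp, by simp⟩
  | succ k ih =>
    intro hk
    obtain ⟨O, E, α, γ, hO, hOk, hE, hEk, hα, hγ, hEA⟩ := ih (by omega)
    obtain ⟨v, hv, hvO⟩ : ∃ v ∈ outV η, v ∉ O := by
      by_contra! h
      have := Finset.card_le_card h
      omega
    obtain ⟨⟨a, ha⟩, hvr⟩ := mem_outV.1 hv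
    obtain ⟨g, hg⟩ := exists_pathLabel b ha
    let A : Δ.V → Prop := fun p => p ∈ Set.range η.toFun ∨ p ∈ O
    have hAγ : ∀ p, A p → PathLabel b Δ (η.toFun (α p)) p (γ p) := by
      rintro p (⟨a, rfl⟩ | hp)
      · rw [(hα a).1, (hα a).2]; exact .nil _
      · exact hγ p hp
    obtain ⟨u, x, w, e, hc, hcross⟩ := hg.exists_crossing (A := A) (.inl ⟨a, rfl⟩)
      (by rintro (h | h) <;> contradiction)
    have hu : Hit η u := (hit_apply a).of_comp_eq hc
    have hw : Hit η w := hu.of_comp_eq (comp_eq_of_adj e)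
    have heE : (⟨(u, x, w), e⟩ : Δ.Edge) ∉ E := fun h => by
      obtain ⟨h1, h2, -⟩ := hEA _ h
      rcases hcross with ⟨-, h⟩ | ⟨h, -⟩
      · exact h h2
      · exact h h1
    have heout : (⟨(u, x, w), e⟩ : Δ.Edge) ∈ outE η := by
      refine mem_outE.2 ⟨hu, ?_⟩
      rintro ⟨a, c, -, h1, h2⟩
      rcases hcross with ⟨-, h⟩ | ⟨h, -⟩
      · exact h (.inl ⟨c, h2⟩)
      · exact h (.inl ⟨a, h1⟩)
    -- Both orientations of the crossing edge are treated at once: `z` is the new end point and `y`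
    -- the one already attached.
    have key : ∀ (z y : Δ.V) (g : F), ¬ A z → A y → Hit η z → PathLabel b Δ y z g →
        (∀ γ' : Δ.V → F, (∀ p, A p → γ' p = γ p) → γ' z = γ y * g → γ' u * b x = γ' w) →
        (u = z ∧ w = y ∨ u = y ∧ w = z) → ∃ (O : Finset Δ.V) (E : Finset Δ.Edge)
          (α : Δ.V → Γ.V) (γ : Δ.V → F),
        O ⊆ outV η ∧ O.card = k + 1 ∧ E ⊆ outE η ∧ E.card = k + 1 ∧
        (∀ a, η.toFun (α (η.toFun a)) = η.toFun a ∧ γ (η.toFun a) = 1) ∧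
        (∀ p ∈ O, PathLabel b Δ (η.toFun (α p)) p (γ p)) ∧
        ∀ e ∈ E, (e.1.1 ∈ Set.range η.toFun ∨ e.1.1 ∈ O) ∧
          (e.1.2.2 ∈ Set.range η.toFun ∨ e.1.2.2 ∈ O) ∧ α e.1.1 = α e.1.2.2 ∧
          γ e.1.1 * b e.1.2.1 = γ e.1.2.2 := by
      intro z y g hz hy hhit hyz hγ' huw
      have hne : ∀ p, A p → p ≠ z := by rintro p hp rfl; exact hz hp
      have hzO : z ∉ O := fun h => hz (.inr h)
      have hAins : ∀ p, A p → p ∈ Set.range η.toFun ∨ p ∈ insert z O := fun p hp =>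
        hp.imp_right Finset.mem_insert_of_mem
      have hzins : z ∈ Set.range η.toFun ∨ z ∈ insert z O := .inr (Finset.mem_insert_self _ _)
      refine ⟨insert z O, insert ⟨(u, x, w), e⟩ E, Function.update α z (α y),
        Function.update γ z (γ y * g), ?_, ?_, ?_, ?_, ?_, ?_, ?_⟩
      · exact Finset.insert_subset (mem_outV.2 ⟨hhit, fun h => hz (.inl h)⟩) hO
      · rw [Finset.card_insert_of_notMem hzO, hOk]
      · exact Finset.insert_subset heout hE
      · rw [Finset.card_insert_of_notMem heE, hEk]
      · intro a
        have := hne _ (.inl ⟨a, rfl⟩)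
        simpa [this] using hα a
      · intro p hp
        rcases Finset.mem_insert.1 hp with rfl | hp
        · simpa using (hAγ y hy).mul hyz
        · simpa [hne p (.inr hp)] using hγ p hp
      · intro e' he'
        rcases Finset.mem_insert.1 he' with rfl | he'
        · refine ⟨?_, ?_, ?_, hγ' _ (fun p hp => by simp [hne p hp]) (by simp)⟩
          · rcases huw with ⟨rfl, rfl⟩ | ⟨rfl, rfl⟩
            · exact hzins
            · exact hAins _ hy
          · rcases huw with ⟨rfl, rfl⟩ | ⟨rfl, rfl⟩
            · exact hAins _ hy
            · exact hzins
          · rcases huw with ⟨rfl, rfl⟩ | ⟨rfl, rfl⟩ <;> simp [hne _ hy]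
        · obtain ⟨h1, h2, h3, h4⟩ := hEA e' he'
          refine ⟨hAins _ h1, hAins _ h2, ?_, ?_⟩
          · simpa [hne _ h1, hne _ h2] using h3
          · simpa [hne _ h1, hne _ h2] using h4
    rcases hcross with ⟨h1, h2⟩ | ⟨h1, h2⟩
    · refine key w u (b x) h2 h1 hw ((PathLabel.fwd e (.nil _)).cast (mul_one _)) ?_
        (.inr ⟨rfl, rfl⟩)
      intro γ' h h'
      rw [h u h1, h']
    · refine key u w (b x)⁻¹ h1 h2 hu ((PathLabel.bwd e (.nil _)).cast (mul_one _)) ?_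
        (.inl ⟨rfl, rfl⟩)
      intro γ' h h'
      rw [h w h2, h', inv_mul_cancel_right]

open Classical in
/-- Pairs that generate the surjective part of `η`, together with the edges outside of a forest,
extend the groupoid of `Γ` to that of `Δ`. -/
theorem exists_gen_of_foldG [Finite B] (b : FreeGroupBasis B F) {L : Finset (Γ.V × Γ.V)}
    (hL : ∀ p ∈ L, η.toFun p.1 = η.toFun p.2)
    (hfold : ∀ a c, η.toFun a = η.toFun c → FoldG Γ.Adj (fun u v => (u, v) ∈ L) a c) :
    ∃ T : Finset (Γ.V × F × Γ.V), Gen b η T ∧ T.card + (outV η).card ≤ L.card + (outE η).card := by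
  rcases isEmpty_or_nonempty Γ.V with hΓ | hΓ
  · refine ⟨∅, ⟨by simp, fun a => isEmptyElim a⟩, ?_⟩
    have : outV η = ∅ := Finset.eq_empty_of_forall_notMem fun p hp =>
      isEmptyElim (mem_outV.1 hp).1.choose
    simp [this]
  obtain ⟨O, E, α, γ, hO, hOk, hE, hEk, hα, hγ, hEA⟩ := exists_forest b η _ le_rfl
  obtain rfl : O = outV η := Finset.eq_of_subset_of_card_le hO hOk.ge
  have hpath : ∀ p, Hit η p → PathLabel b Δ (η.toFun (α p)) p (γ p) := by
    intro p hp
    by_cases hr : p ∈ Set.range η.toFun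
    · obtain ⟨a, rfl⟩ := hr
      rw [(hα a).1, (hα a).2]; exact .nil _
    · exact hγ p (mem_outV.2 ⟨hp, hr⟩)
  -- The gauge `γ` trivializes the forest edges, so that only the outer edges not in `E` need
  -- triples.
  let T : Finset (Γ.V × F × Γ.V) := L.image (fun p => (p.1, 1, p.2)) ∪
    (outE η \ E).image fun e => (α e.1.1, γ e.1.1 * b e.1.2.1 * (γ e.1.2.2)⁻¹, α e.1.2.2)
  have hker : ∀ a c, η.toFun a = η.toFun c → GPath (genRel b Γ T) a c 1 := by
    intro a c h
    refine ((hfold a c h).gpath b).mono ?_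
    rintro u g v (h | ⟨rfl, h⟩)
    · exact .inl h
    · exact .inr (Finset.mem_union_left _ (Finset.mem_image.2 ⟨_, h, rfl⟩))
  refine ⟨T, ⟨?_, ?_⟩, ?_⟩
  · intro t ht
    rcases Finset.mem_union.1 ht with ht | ht
    · obtain ⟨p, hp, rfl⟩ := Finset.mem_image.1 ht
      have := PathLabel.nil (b := b) (η.toFun p.1)
      exact (hL p hp) ▸ this
    · obtain ⟨e, he, rfl⟩ := Finset.mem_image.1 ht
      have hh := (mem_outE.1 (Finset.mem_sdiff.1 he).1).1
      exact ((hpath _ hh).mul ((PathLabel.fwd e.2 (.nil _)).cast (mul_one _))).mul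
        (hpath _ (hh.of_comp_eq (comp_eq_of_adj e.2))).inv
  · intro a c g hg
    -- `α` chooses just one preimage of each image vertex; the paths with label `1` from `hker` lead
    -- from `a` and `c` to the chosen preimages.
    have := (pathLabel_iff.1 hg).gaugeOn (S' := genRel b Γ T) (Hit η) α γ ?_ ?_ (hit_apply a)
    · rw [(hα a).2, (hα c).2] at this
      exact (((hker _ _ (hα a).1.symm).mul this).mul (hker _ _ (hα c).1)).cast (by group)
    · rintro p _ q ⟨x, e, rfl⟩
      exact Hit.iff_of_comp_eq (comp_eq_of_adj e)
    · rintro p _ q hp hq ⟨x, e, rfl⟩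
      by_cases him : InImage η p x q
      · obtain ⟨a, c, h, rfl, rfl⟩ := him
        rw [(hα a).2, (hα c).2]
        exact (((hker _ _ (hα a).1).mul (.single (.inl ⟨x, h, rfl⟩))).mul
          (hker _ _ (hα c).1.symm)).cast (by group)
      · by_cases heE : (⟨(p, x, q), e⟩ : Δ.Edge) ∈ E
        · obtain ⟨-, -, h1, h2⟩ := hEA _ heE
          dsimp only at h1 h2
          rw [h2, h1, mul_inv_cancel]
          exact .nil _
        · exact .single (.inr (Finset.mem_union_right _ (Finset.mem_image.2
            ⟨⟨(p, x, q), e⟩, Finset.mem_sdiff.2 ⟨mem_outE.2 ⟨hp, him⟩, heE⟩, rfl⟩)))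
  · have h1 : T.card ≤ L.card + ((outE η).card - E.card) :=
      (Finset.card_union_le _ _).trans (Nat.add_le_add Finset.card_image_le
        (Finset.card_image_le.trans (Finset.card_sdiff_of_subset hE).le))
    have h2 := Finset.card_le_card hE
    omega

end Outside

/-! ### A subgraph of a core graph that carries the groupoid -/

section Coverage

variable {B F : Type*} [Group F] {b : FreeGroupBasis B F} {Δ : MultiCoreGraph B}

/-- Half-edges are pairs of an edge and a choice of its tail (`false`) or head (`true`), so a loop
gives two of them at its vertex, as in the degree condition. -/
theorem two_mul_card_le_half_edges [Fintype Δ.Edge] [DecidableEq Δ.V] (U : Finset Δ.V) :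
    2 * U.card ≤ ((Finset.univ : Finset (Δ.Edge × Bool)).filter
      fun h => (bif h.2 then h.1.1.2.2 else h.1.1.1) ∈ U).card := by
  have hsum := Finset.card_eq_sum_card_fiberwise
    (s := (Finset.univ : Finset (Δ.Edge × Bool)).filter
      fun h => (bif h.2 then h.1.1.2.2 else h.1.1.1) ∈ U)
    (f := fun h : Δ.Edge × Bool => bif h.2 then h.1.1.2.2 else h.1.1.1) (t := U)
    (fun h hh => (Finset.mem_filter.1 hh).2)
  refine le_of_le_of_eq ?_ hsum.symm
  rw [mul_comm, ← smul_eq_mul]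
  refine Finset.card_nsmul_le_sum _ _ _ fun v hv => (Δ.two_le_degree v).trans ?_
  have hf1 : Finite {p : B × Δ.V // Δ.Adj v p.1 p.2} :=
    Finite.of_injective (β := Δ.Edge) (fun p => ⟨(v, p.1.1, p.1.2), p.2⟩) (by
      rintro ⟨⟨x, q⟩, h⟩ ⟨⟨x', q'⟩, h'⟩ e
      simpa using e)
  have hf2 : Finite {p : Δ.V × B // Δ.Adj p.1 p.2 v} :=
    Finite.of_injective (β := Δ.Edge) (fun p => ⟨(p.1.1, p.1.2, v), p.2⟩) (by
      rintro ⟨⟨x, q⟩, h⟩ ⟨⟨x', q'⟩, h'⟩ e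
      simpa using e)
  rw [← Nat.card_sum, ← Nat.card_eq_finsetCard]
  refine Nat.card_le_card_of_injective (Sum.elim
    (fun p => ⟨(⟨(v, p.1.1, p.1.2), p.2⟩, false), by simpa using hv⟩)
    (fun p => ⟨(⟨(p.1.1, p.1.2, v), p.2⟩, true), by simpa using hv⟩)) ?_
  rintro (⟨⟨x, q⟩, h⟩ | ⟨⟨x, q⟩, h⟩) (⟨⟨x', q'⟩, h'⟩ | ⟨⟨x', q'⟩, h'⟩) e <;> simp_all

variable {VA : Δ.V → Prop} {EA : Δ.V → B → Δ.V → Prop}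

/-- If a subgraph carries the fundamental groupoid, then every function on edges that vanishes on the
subgraph is the coboundary of a function on vertices that vanishes on the subgraph. -/
theorem exists_primitive (hsub : ∀ p x q, EA p x q → Δ.Adj p x q ∧ VA p ∧ VA q)
    (hgen : ∀ p q g, VA p → VA q → PathLabel b Δ p q g → GPath (lab b EA) p q g)
    {A : Type*} [AddCommGroup A] (f : Δ.Edge → A)
    (hf : ∀ e : Δ.Edge, EA e.1.1 e.1.2.1 e.1.2.2 → f e = 0) :
    ∃ h : Δ.V → A, (∀ p, VA p → h p = 0) ∧ ∀ e : Δ.Edge,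
      (∃ a, VA a ∧ Δ.comp a = Δ.comp e.1.1) → h e.1.2.2 = h e.1.1 + f e := by
  -- This is the covering graph of Δ with voltages `f`; it is again folded. The primitive at `p` is
  -- the height at which a lift ends over `p` if it starts at height `0` over the subgraph.
  let AdjQ : Δ.V × A → B → Δ.V × A → Prop :=
    fun p x q => ∃ e : Δ.Adj p.1 x q.1, q.2 = p.2 + f ⟨(p.1, x, q.1), e⟩
  have hQ1 : ∀ u x v v', AdjQ u x v → AdjQ u x v' → v = v' := by
    rintro ⟨p, s⟩ x ⟨q, t⟩ ⟨q', t'⟩ ⟨e, h⟩ ⟨e', h'⟩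
    obtain rfl : q = q' := Δ.out_unique e e'
    exact Prod.ext rfl (h.trans h'.symm)
  have hQ2 : ∀ u u' x v, AdjQ u x v → AdjQ u' x v → u = u' := by
    rintro ⟨p, s⟩ ⟨p', s'⟩ x ⟨q, t⟩ ⟨e, h⟩ ⟨e', h'⟩
    obtain rfl : p = p' := Δ.in_unique e e'
    exact Prod.ext rfl (add_right_cancel (h.symm.trans h'))
  have hlift : ∀ {p q g}, PathLabel b Δ p q g → ∀ s, ∃ t, GPath (lab b AdjQ) (p, s) (q, t) g := by
    intro p q g h
    induction h with
    | nil p => exact fun s => ⟨s, .nil _⟩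
    | @fwd p q r x g e _ ih =>
      intro s
      obtain ⟨t, ht⟩ := ih (s + f ⟨(p, x, q), e⟩)
      exact ⟨t, .fwd ⟨x, ⟨e, rfl⟩, rfl⟩ ht⟩
    | @bwd p q r x g e _ ih =>
      intro s
      obtain ⟨t, ht⟩ := ih (s - f ⟨(q, x, p), e⟩)
      exact ⟨t, .bwd ⟨x, ⟨e, by simp⟩, rfl⟩ ht⟩
  have hproj : ∀ {p q g}, GPath (lab b AdjQ) p q g → PathLabel b Δ p.1 q.1 g := by
    intro p q g h
    refine pathLabel_iff.2 (h.map Prod.fst ?_)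
    rintro p _ q ⟨x, ⟨e, -⟩, rfl⟩
    exact .single ⟨x, e, rfl⟩
  have hEA : ∀ {p q g}, GPath (lab b EA) p q g → ∀ s, GPath (lab b AdjQ) (p, s) (q, s) g := by
    intro p q g h s
    refine h.map (fun p => (p, s)) ?_
    rintro p _ q ⟨x, e, rfl⟩
    exact .single ⟨x, ⟨(hsub _ _ _ e).1, by rw [hf _ e, add_zero]⟩, rfl⟩
  have hshift : ∀ {p q g s t} (k : A), GPath (lab b AdjQ) (p, s) (q, t) g →
      GPath (lab b AdjQ) (p, s + k) (q, t + k) g := by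
    intro p q g s t k h
    refine h.map (fun p => (p.1, p.2 + k)) ?_
    rintro p _ q ⟨x, ⟨e, h⟩, rfl⟩
    refine .single ⟨x, ⟨e, ?_⟩, rfl⟩
    dsimp only
    rw [h, add_right_comm]
  -- The height does not depend on the path: one path followed by the reverse of the other runs
  -- between vertices of the subgraph, so a path inside the subgraph has the same label. The latter
  -- lifts at constant height, and in the folded cover label and terminal point determine the
  -- initial point.
  have key : ∀ {a a' v s s' g g'}, VA a → VA a' → GPath (lab b AdjQ) (a, 0) (v, s) g →
      GPath (lab b AdjQ) (a', 0) (v, s') g' → s = s' := by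
    intro a a' v s s' g g' ha ha' h h'
    have h2 := hshift (s - s') h'
    rw [zero_add, add_sub_cancel] at h2
    have h3 := h.mul h2.inv
    have h4 := hEA (hgen _ _ _ ha ha' (hproj h3)) (s - s')
    have := congrArg Prod.snd (h3.unique_of_folded b hQ1 hQ2 h4)
    exact (sub_eq_zero.1 this.symm)
  have hh : ∀ p, ∃ s, (∃ a, VA a ∧ Δ.comp a = Δ.comp p) →
      ∃ a g, VA a ∧ GPath (lab b AdjQ) (a, 0) (p, s) g := by
    intro p
    by_cases hp : ∃ a, VA a ∧ Δ.comp a = Δ.comp p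
    · obtain ⟨a, ha, h⟩ := hp
      obtain ⟨g, hg⟩ := exists_pathLabel b h
      obtain ⟨t, ht⟩ := hlift hg 0
      exact ⟨t, fun _ => ⟨a, g, ha, ht⟩⟩
    · exact ⟨0, fun h => absurd h hp⟩
  choose h hh using hh
  refine ⟨h, ?_, ?_⟩
  · intro p hp
    obtain ⟨a, g, ha, hg⟩ := hh p ⟨p, hp, rfl⟩
    exact key ha hp hg (.nil _)
  · rintro ⟨⟨p, x, q⟩, e⟩ hp
    obtain ⟨a, g, ha, hg⟩ := hh p hp
    obtain ⟨a', ha', hc⟩ := hp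
    obtain ⟨a', g', ha', hg'⟩ := hh q ⟨a', ha', hc.trans (comp_eq_of_adj e)⟩
    exact key ha' ha hg' (hg.mul (.single ⟨x, ⟨e, rfl⟩, rfl⟩))

open Classical in
/-- A subgraph of a core graph that carries the fundamental groupoid is a union of components. -/
theorem subgraph_eq_of_generates [Finite B]
    (hsub : ∀ p x q, EA p x q → Δ.Adj p x q ∧ VA p ∧ VA q)
    (hgen : ∀ p q g, VA p → VA q → PathLabel b Δ p q g → GPath (lab b EA) p q g)
    {p q : Δ.V} {x : B} (e : Δ.Adj p x q) (hp : ∃ a, VA a ∧ Δ.comp a = Δ.comp p) : EA p x q := by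
  by_contra hcon
  have := Fintype.ofFinite Δ.Edge
  have := Fintype.ofFinite Δ.V
  let H : Δ.V → Prop := fun p => ∃ a, VA a ∧ Δ.comp a = Δ.comp p
  have hH : ∀ {p x q}, Δ.Adj p x q → (H p ↔ H q) := by
    intro p x q e
    simp only [H, comp_eq_of_adj e]
  let U : Finset Δ.V := Finset.univ.filter fun p => H p ∧ ¬ VA p
  let E : Finset Δ.Edge := Finset.univ.filter fun e => H e.1.1 ∧ ¬ EA e.1.1 e.1.2.1 e.1.2.2
  have hU : ∀ {p}, p ∈ U ↔ H p ∧ ¬ VA p := by simp [U]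
  have hE : ∀ {e}, e ∈ E ↔ H e.1.1 ∧ ¬ EA e.1.1 e.1.2.1 e.1.2.2 := by simp [E]
  -- The relative first cohomology vanishes: every function on `E` is the coboundary of a function
  -- on `U`. With values in the finite group `ZMod 2` this surjectivity is an inequality of
  -- cardinalities.
  have hEU : E.card ≤ U.card := by
    let ext : (U → ZMod 2) → Δ.V → ZMod 2 := fun k p => if h : p ∈ U then k ⟨p, h⟩ else 0
    let δ : (U → ZMod 2) → (E → ZMod 2) := fun k e => ext k e.1.1.2.2 - ext k e.1.1.1
    have hδ : Function.Surjective δ := by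
      intro f
      obtain ⟨h, h0, h1⟩ := exists_primitive hsub hgen
        (fun e => if he : e ∈ E then f ⟨e, he⟩ else 0)
        (fun e he => dif_neg fun h => (hE.1 h).2 he)
      have hext : ∀ p, H p → ext (fun p => h p.1) p = h p := by
        intro p hp
        by_cases hpU : p ∈ U
        · exact dif_pos hpU
        · rw [h0 p (by by_contra hv; exact hpU (hU.2 ⟨hp, hv⟩))]
          exact dif_neg hpU
      refine ⟨fun p => h p.1, funext fun ⟨e, he⟩ => ?_⟩
      have hp := (hE.1 he).1
      have := h1 e hp
      rw [dif_pos he] at this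
      simp only [δ]
      rw [hext _ hp, hext _ ((hH e.2).1 hp), this, add_sub_cancel_left]
    have hc := Fintype.card_le_of_surjective δ hδ
    simp only [Fintype.card_fun, ZMod.card, Fintype.card_coe] at hc
    exact (Nat.pow_le_pow_iff_right (by norm_num)).1 hc
  let D := (Finset.univ : Finset (Δ.Edge × Bool)).filter
      fun h => (bif h.2 then h.1.1.2.2 else h.1.1.1) ∈ U
  have hD : D ⊆ E ×ˢ Finset.univ := by
    rintro ⟨e, s⟩ h
    have h := (Finset.mem_filter.1 h).2
    refine Finset.mem_product.2 ⟨hE.2 ?_, Finset.mem_univ _⟩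
    cases s
    · have := hU.1 h
      exact ⟨this.1, fun he => this.2 (hsub _ _ _ he).2.1⟩
    · have := hU.1 h
      exact ⟨(hH e.2).2 this.1, fun he => this.2 (hsub _ _ _ he).2.2⟩
  -- The chain 2|U| ≤ |D| ≤ 2|E| ≤ 2|U| consists of equalities, so both ends of every edge in `E`
  -- lie in `U`.
  have hDE : D = E ×ˢ Finset.univ := by
    refine Finset.eq_of_subset_of_card_le hD ?_
    have := two_mul_card_le_half_edges U
    rw [Finset.card_product, Finset.card_univ, Fintype.card_bool]
    refine le_trans ?_ this
    omega
  have hends : ∀ e ∈ E, ¬ VA e.1.1 ∧ ¬ VA e.1.2.2 := by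
    intro e he
    have h1 : (e, false) ∈ D := hDE ▸ Finset.mem_product.2 ⟨he, Finset.mem_univ _⟩
    have h2 : (e, true) ∈ D := hDE ▸ Finset.mem_product.2 ⟨he, Finset.mem_univ _⟩
    exact ⟨(hU.1 (Finset.mem_filter.1 h1).2).2, (hU.1 (Finset.mem_filter.1 h2).2).2⟩
  -- A path from the subgraph to `p` crosses the boundary along an edge of `E` that has an end in
  -- the subgraph, a contradiction.
  obtain ⟨a, ha, hap⟩ := id hp
  obtain ⟨g, hg⟩ := exists_pathLabel b hap
  obtain ⟨u, y, w, e', hc, h⟩ := hg.exists_crossing ha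
    (hends ⟨(p, x, q), e⟩ (hE.2 ⟨hp, hcon⟩)).1
  have he' : (⟨(u, y, w), e'⟩ : Δ.Edge) ∈ E := by
    refine hE.2 ⟨⟨a, ha, hc⟩, fun he => ?_⟩
    have := (hsub _ _ _ he).2
    dsimp only at this
    tauto
  have := hends _ he'
  dsimp only at this
  tauto

end Coverage

/-! ### Replacing labeled triples by chains of separate edges -/

section Arcs

variable {B F : Type*} [Group F] {b : FreeGroupBasis B F} {Γ Δ : MultiCoreGraph B}

/-- The vertices of `Γ` together with the end points of separate edges, which are copies of edges of
`Δ`. -/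
abbrev ArcV (Γ Δ : MultiCoreGraph B) := Γ.V ⊕ ((Δ.Edge × ℕ) × Bool)

/-- The map to the vertices of `Δ`. -/
def arcProj (η : Hom Γ Δ) : ArcV Γ Δ → Δ.V :=
  Sum.elim η.toFun fun p => bif p.2 then p.1.1.1.2.2 else p.1.1.1.1

/-- The edges of `Γ` together with the separate edges that belong to `S`. -/
def arcAdj (Γ : MultiCoreGraph B) (S : Finset (Δ.Edge × ℕ)) : ArcV Γ Δ → B → ArcV Γ Δ → Prop :=
  fun u x v => (∃ a c, Γ.Adj a x c ∧ u = .inl a ∧ v = .inl c) ∨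
    ∃ i ∈ S, u = .inr (i, false) ∧ x = i.1.1.2.1 ∧ v = .inr (i, true)

/-- The vertices of `Γ` and the end points of the edges that belong to `S`. -/
def Active (S : Finset (Δ.Edge × ℕ)) : ArcV Γ Δ → Prop := Sum.elim (fun _ => True) fun p => p.1 ∈ S

/-- Edges labeled by basis elements, pairs of glued vertices and edges with arbitrary labels. -/
def arcRel (b : FreeGroupBasis B F) (S : Finset (Δ.Edge × ℕ)) (L : Finset (ArcV Γ Δ × ArcV Γ Δ))
    (T : Finset (ArcV Γ Δ × F × ArcV Γ Δ)) : ArcV Γ Δ → F → ArcV Γ Δ → Prop :=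
  fun u g v => lab b (arcAdj Γ S) u g v ∨ (g = 1 ∧ (u, v) ∈ L) ∨ (u, g, v) ∈ T

/-- The pairs in `L` are compatible with `η`, and the edges in `S` meet the right components. -/
structure ArcData (η : Hom Γ Δ) (S : Finset (Δ.Edge × ℕ)) (L : Finset (ArcV Γ Δ × ArcV Γ Δ)) :
    Prop where
  active : ∀ p ∈ L, Active S p.1 ∧ Active S p.2
  proj : ∀ p ∈ L, arcProj η p.1 = arcProj η p.2
  hit : ∀ i ∈ S, Hit η i.1.1.1

/-- The edges, pairs and labeled edges generate the groupoid induced from `Δ`. -/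
structure Expanded (b : FreeGroupBasis B F) (η : Hom Γ Δ) (S : Finset (Δ.Edge × ℕ))
    (L : Finset (ArcV Γ Δ × ArcV Γ Δ)) (T : Finset (ArcV Γ Δ × F × ArcV Γ Δ)) : Prop
    extends ArcData η S L where
  full : ∀ u v g, Active S u → Active S v → PathLabel b Δ (arcProj η u) (arcProj η v) g →
    GPath (arcRel b S L T) u v g

variable {η : Hom Γ Δ} {S : Finset (Δ.Edge × ℕ)} {L : Finset (ArcV Γ Δ × ArcV Γ Δ)}
  {T : Finset (ArcV Γ Δ × F × ArcV Γ Δ)}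

theorem Active.mono {S' : Finset (Δ.Edge × ℕ)} (h : S ⊆ S') {u : ArcV Γ Δ} (hu : Active S u) :
    Active S' u := by
  rcases u with a | p
  · trivial
  · exact h hu

theorem ArcData.hit_of_active (h : ArcData η S L) {u : ArcV Γ Δ} (hu : Active S u) :
    Hit η (arcProj η u) := by
  rcases u with a | ⟨i, s⟩
  · exact hit_apply a
  · cases s
    · exact h.hit i hu
    · exact (h.hit i hu).of_comp_eq (comp_eq_of_adj i.1.2)

theorem arcAdj_proj {u v : ArcV Γ Δ} {x : B} (h : arcAdj Γ S u x v) :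
    Δ.Adj (arcProj η u) x (arcProj η v) := by
  rcases h with ⟨a, c, h, rfl, rfl⟩ | ⟨i, -, rfl, rfl, rfl⟩
  · exact η.map_adj h
  · exact i.1.2

theorem arcAdj_active {u v : ArcV Γ Δ} {x : B} (h : arcAdj Γ S u x v) :
    Active S u ∧ Active S v := by
  rcases h with ⟨a, c, h, rfl, rfl⟩ | ⟨i, hi, rfl, rfl, rfl⟩
  · exact ⟨trivial, trivial⟩
  · exact ⟨hi, hi⟩

theorem FoldG.arcProj_eq (hL : ∀ p ∈ L, arcProj η p.1 = arcProj η p.2) {u v : ArcV Γ Δ}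
    (h : FoldG (arcAdj Γ S) (fun u v => (u, v) ∈ L) u v) : arcProj η u = arcProj η v :=
  h.apply_eq (AdjX := Δ.Adj) _ (fun _ _ _ _ => Δ.out_unique) (fun _ _ _ _ => Δ.in_unique)
    (fun _ _ _ => arcAdj_proj) (fun u v h => hL (u, v) h)

open Classical in
/-- Split off the first letter of the label of an edge, as a new separate edge. -/
theorem Expanded.split {u v : ArcV Γ Δ} {g l : F} {i : Δ.Edge × ℕ} {s : Bool}
    (hu : Active S u) (hi : i ∉ S) (hs : arcProj η (.inr (i, s)) = arcProj η u)
    (hl : s = false ∧ l = b i.1.1.2.1 ∨ s = true ∧ l = (b i.1.1.2.1)⁻¹)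
    (h : Expanded b η S L (insert (u, l * g, v) T)) :
    Expanded b η (insert i S) (insert (u, .inr (i, s)) L) (insert (.inr (i, !s), g, v) T) := by
  have hsub : S ⊆ insert i S := Finset.subset_insert _ _
  have hiS : i ∈ insert i S := Finset.mem_insert_self _ _
  let R := arcRel b (insert i S) (insert (u, Sum.inr (i, s)) L)
    (insert ((Sum.inr (i, !s) : ArcV Γ Δ), g, v) T)
  have h1 : GPath R u (.inr (i, s)) 1 := .single (.inr (.inl ⟨rfl, Finset.mem_insert_self _ _⟩))
  have h2 : GPath R (.inr (i, s)) (.inr (i, !s)) l := by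
    have h0 : R (.inr (i, false)) (b i.1.1.2.1) (.inr (i, true)) :=
      .inl ⟨_, .inr ⟨i, hiS, rfl, rfl, rfl⟩, rfl⟩
    rcases hl with ⟨rfl, rfl⟩ | ⟨rfl, rfl⟩
    · exact .single h0
    · exact (GPath.single h0).inv
  have h3 : GPath R (.inr (i, !s)) v g := .single (.inr (.inr (Finset.mem_insert_self _ _)))
  have h4 : PathLabel b Δ (arcProj η (.inr (i, s) : ArcV Γ Δ)) (arcProj η (.inr (i, !s) : ArcV Γ Δ))
      l := by
    have h0 := (PathLabel.fwd (b := b) i.1.2 (.nil _)).cast (mul_one _)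
    rcases hl with ⟨rfl, rfl⟩ | ⟨rfl, rfl⟩
    · exact h0
    · exact h0.inv
  have hbind : ∀ {w z k}, GPath (arcRel b S L (insert (u, l * g, v) T)) w z k → GPath R w z k := by
    intro w z k hw
    refine hw.bind ?_
    rintro w k z (⟨x, e, rfl⟩ | ⟨rfl, e⟩ | e)
    · refine .single (.inl ⟨x, ?_, rfl⟩)
      exact e.imp_right fun ⟨j, hj, h⟩ => ⟨j, hsub hj, h⟩
    · exact .single (.inr (.inl ⟨rfl, Finset.mem_insert_of_mem e⟩))
    · rcases Finset.mem_insert.1 e with e | e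
      · cases e
        exact ((h1.mul h2).mul h3).cast (by group)
      · exact .single (.inr (.inr (Finset.mem_insert_of_mem e)))
  -- The new edge hangs at `u`, so paths between new end points reduce to paths between vertices
  -- that were active before.
  have hcon : ∀ w, Active (insert i S) w → ∃ w' k, Active S w' ∧ GPath R w w' k ∧
      PathLabel b Δ (arcProj η w) (arcProj η w') k := by
    rintro (a | ⟨j, t⟩) hw
    · exact ⟨.inl a, 1, trivial, .nil _, .nil _⟩
    · by_cases hj : j = i
      · subst hj
        by_cases hst : t = s
        · subst hst
          refine ⟨u, 1, hu, by simpa using h1.inv, ?_⟩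
          rw [hs]
          exact .nil _
        · obtain rfl : t = !s := by cases t <;> cases s <;> simp_all
          refine ⟨u, l⁻¹, hu, (h1.mul h2).inv.cast (by group), ?_⟩
          rw [← hs]
          exact h4.inv
      · exact ⟨.inr (j, t), 1, (Finset.mem_insert.1 hw).resolve_left hj, .nil _, .nil _⟩
  refine ⟨⟨?_, ?_, ?_⟩, ?_⟩
  · intro p hp
    rcases Finset.mem_insert.1 hp with rfl | hp
    · exact ⟨hu.mono hsub, hiS⟩
    · exact ⟨(h.active p hp).1.mono hsub, (h.active p hp).2.mono hsub⟩
  · intro p hp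
    rcases Finset.mem_insert.1 hp with rfl | hp
    · exact hs.symm
    · exact h.proj p hp
  · intro j hj
    rcases Finset.mem_insert.1 hj with rfl | hj
    · have := h.hit_of_active hu
      rw [← hs] at this
      cases s
      · exact this
      · exact this.of_comp_eq (comp_eq_of_adj j.1.2).symm
    · exact h.hit j hj
  · intro w z k hw hz hk
    obtain ⟨w', m, hw', hm, hm'⟩ := hcon w hw
    obtain ⟨z', n, hz', hn, hn'⟩ := hcon z hz
    exact ((hm.mul (hbind (h.full w' z' _ hw' hz' ((hm'.inv.mul hk).mul hn')))).mul hn.inv).cast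
      (by group)

-- Each letter of the label adds one separate edge and at most one pair; the empty word left at the
-- end adds at most one more pair. This extra pair is the `1` in the count, and the excess of pairs
-- over edges grows by at most one per triple.
open Classical in
theorem Expanded.expand_one {p q : Δ.V} {g : F} (hg : PathLabel b Δ p q g) :
    ∀ (S : Finset (Δ.Edge × ℕ)) (L : Finset (ArcV Γ Δ × ArcV Γ Δ)) (u v : ArcV Γ Δ),
      Active S u → Active S v → arcProj η u = p → arcProj η v = q →
      Expanded b η S L (insert (u, g, v) T) → ∃ S' L', S ⊆ S' ∧
        L'.card + S.card ≤ L.card + 1 + S'.card ∧ Expanded b η S' L' T := by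
  -- An edge of Δ may be traversed repeatedly, so each traversal takes a copy with an unused index.
  have fresh : ∀ (S : Finset (Δ.Edge × ℕ)) (e : Δ.Edge), ∃ N, (e, N) ∉ S := by
    intro S e
    obtain ⟨N, hN⟩ := Infinite.exists_notMem_finset (S.image Prod.snd)
    exact ⟨N, fun h => hN (Finset.mem_image_of_mem Prod.snd h)⟩
  have step : ∀ (S : Finset (Δ.Edge × ℕ)) (L : Finset (ArcV Γ Δ × ArcV Γ Δ)) (u v : ArcV Γ Δ)
      (i : Δ.Edge × ℕ), i ∉ S → (∃ S' L', insert i S ⊆ S' ∧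
        L'.card + (insert i S).card ≤ (insert (u, v) L).card + 1 + S'.card ∧
          Expanded b η S' L' T) → ∃ S' L', S ⊆ S' ∧
        L'.card + S.card ≤ L.card + 1 + S'.card ∧ Expanded b η S' L' T := by
    rintro S L u v i hi ⟨S', L', h1, h2, h3⟩
    refine ⟨S', L', (Finset.subset_insert _ _).trans h1, ?_, h3⟩
    have := Finset.card_insert_le (u, v) L
    rw [Finset.card_insert_of_notMem hi] at h2
    omega
  induction hg with
  | nil p =>
    intro S L u v hu hv hup hvp h
    refine ⟨S, insert (u, v) L, subset_rfl,
      Nat.add_le_add_right (Finset.card_insert_le _ _) _, ⟨⟨?_, ?_, h.hit⟩, ?_⟩⟩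
    · intro p hp
      rcases Finset.mem_insert.1 hp with rfl | hp
      · exact ⟨hu, hv⟩
      · exact h.active p hp
    · intro p hp
      rcases Finset.mem_insert.1 hp with rfl | hp
      · exact hup.trans hvp.symm
      · exact h.proj p hp
    · intro w z k hw hz hk
      refine (h.full w z k hw hz hk).mono ?_
      rintro w k z (e | ⟨rfl, e⟩ | e)
      · exact .inl e
      · exact .inr (.inl ⟨rfl, Finset.mem_insert_of_mem e⟩)
      · rcases Finset.mem_insert.1 e with e | e
        · cases e
          exact .inr (.inl ⟨rfl, Finset.mem_insert_self _ _⟩)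
        · exact .inr (.inr e)
  | @fwd p q r x g e _ ih =>
    intro S L u v hu hv hup hvp h
    obtain ⟨N, hN⟩ := fresh S ⟨(p, x, q), e⟩
    exact step S L u _ _ hN (ih _ _ (.inr ((⟨(p, x, q), e⟩, N), true)) v
      (Finset.mem_insert_self _ _) (hv.mono (Finset.subset_insert _ _)) rfl hvp
      (h.split (s := false) hu hN hup.symm (.inl ⟨rfl, rfl⟩)))
  | @bwd p q r x g e _ ih =>
    intro S L u v hu hv hup hvp h
    obtain ⟨N, hN⟩ := fresh S ⟨(q, x, p), e⟩
    exact step S L u _ _ hN (ih _ _ (.inr ((⟨(q, x, p), e⟩, N), false)) v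
      (Finset.mem_insert_self _ _) (hv.mono (Finset.subset_insert _ _)) rfl hvp
      (h.split (s := true) hu hN hup.symm (.inr ⟨rfl, rfl⟩)))

open Classical in
theorem Expanded.expand (T : Finset (ArcV Γ Δ × F × ArcV Γ Δ)) :
    ∀ (S : Finset (Δ.Edge × ℕ)) (L : Finset (ArcV Γ Δ × ArcV Γ Δ)),
      (∀ t ∈ T, Active S t.1 ∧ Active S t.2.2 ∧
        PathLabel b Δ (arcProj η t.1) (arcProj η t.2.2) t.2.1) →
      Expanded b η S L T → ∃ S' L', L'.card + S.card ≤ L.card + T.card + S'.card ∧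
        Expanded b η S' L' ∅ := by
  induction T using Finset.induction_on with
  | empty => exact fun S L _ h => ⟨S, L, by simp, h⟩
  | insert t T ht ih =>
    intro S L hT h
    obtain ⟨h1, h2, h3⟩ := hT t (Finset.mem_insert_self _ _)
    obtain ⟨S1, L1, hS, hc, hE⟩ := expand_one h3 S L t.1 t.2.2 h1 h2 rfl rfl h
    obtain ⟨S2, L2, hc', hE'⟩ := ih S1 L1 (fun t ht => by
      obtain ⟨h1, h2, h3⟩ := hT t (Finset.mem_insert_of_mem ht)
      exact ⟨h1.mono hS, h2.mono hS, h3⟩) hE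
    refine ⟨S2, L2, ?_, hE'⟩
    rw [Finset.card_insert_of_notMem ht]
    omega

/-- Gluing along `L` and folding identifies all vertices with the same image in `Δ`, and the
edges of `S` together with those of `Γ` cover the edges of `Δ`. -/
structure FoldsOnto (η : Hom Γ Δ) (S : Finset (Δ.Edge × ℕ)) (L : Finset (ArcV Γ Δ × ArcV Γ Δ)) :
    Prop extends ArcData η S L where
  fold : ∀ u v, Active S u → Active S v → arcProj η u = arcProj η v →
    FoldG (arcAdj Γ S) (fun u v => (u, v) ∈ L) u v
  cover : ∀ e : Δ.Edge, Hit η e.1.1 → InImage η e.1.1 e.1.2.1 e.1.2.2 ∨ ∃ i ∈ S, i.1 = e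

-- When all triples have been expanded, equality of images gives a path with label `1`, hence an
-- identification by folding. Coverage of the edges follows because the image of the expanded graph
-- carries the groupoid of Δ.
open Classical in
theorem Gen.exists_foldsOnto [Finite B] {T : Finset (Γ.V × F × Γ.V)} (hT : Gen b η T) :
    ∃ S L, L.card ≤ T.card + S.card ∧ FoldsOnto η S L := by
  obtain ⟨S, L, hc, h⟩ := Expanded.expand (b := b) (η := η)
    (T.image fun t => (.inl t.1, t.2.1, .inl t.2.2)) ∅ ∅
    (by
      intro t ht
      obtain ⟨r, hr, rfl⟩ := Finset.mem_image.1 ht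
      exact ⟨trivial, trivial, hT.1 r hr⟩)
    ⟨⟨by simp, by simp, by simp⟩, by
      rintro (a | p) (c | q) g hu hv hg
      · refine (hT.2 a c g hg).map _ ?_
        rintro a _ c (⟨x, e, rfl⟩ | e)
        · exact .single (.inl ⟨x, .inl ⟨a, c, e, rfl, rfl⟩, rfl⟩)
        · exact .single (.inr (.inr (Finset.mem_image.2 ⟨_, e, rfl⟩)))
      · simp [Active] at hv
      · simp [Active] at hu
      · simp [Active] at hv⟩
  have hTc : (T.image fun t => ((.inl t.1, t.2.1, .inl t.2.2) : ArcV Γ Δ × F × ArcV Γ Δ)).card ≤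
    T.card := Finset.card_image_le
  refine ⟨S, L, ?_, h.toArcData, ?_, ?_⟩
  · simp only [Finset.card_empty] at hc
    omega
  · intro u v hu hv huv
    refine FoldG.of_gpath b ((h.full u v 1 hu hv (huv ▸ .nil _)).mono ?_)
    rintro u g v (e | e | e)
    · exact .inl e
    · exact .inr e
    · simp at e
  · rintro ⟨⟨p, x, q⟩, e⟩ ⟨a, ha⟩
    have := subgraph_eq_of_generates (b := b) (Δ := Δ)
      (VA := fun p => ∃ u : ArcV Γ Δ, Active S u ∧ arcProj η u = p)
      (EA := fun p x q => ∃ u v : ArcV Γ Δ, arcAdj Γ S u x v ∧ arcProj η u = p ∧ arcProj η v = q)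
      ?_ ?_ e ⟨_, ⟨.inl a, trivial, rfl⟩, ha⟩
    · obtain ⟨_, _, ⟨a, c, h, rfl, rfl⟩ | ⟨i, hi, rfl, rfl, rfl⟩, rfl, rfl⟩ := this
      · exact .inl ⟨a, c, h, rfl, rfl⟩
      · exact .inr ⟨i, hi, rfl⟩
    · rintro _ x _ ⟨u, v, h, rfl, rfl⟩
      exact ⟨arcAdj_proj h, ⟨u, (arcAdj_active h).1, rfl⟩, ⟨v, (arcAdj_active h).2, rfl⟩⟩
    · rintro _ _ g ⟨u, hu, rfl⟩ ⟨v, hv, rfl⟩ hg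
      refine (h.full u v g hu hv hg).map (arcProj η) ?_
      rintro u g v (⟨x, e, rfl⟩ | ⟨rfl, e⟩ | e)
      · exact .single ⟨x, ⟨u, v, e, rfl, rfl⟩, rfl⟩
      · rw [show arcProj η u = arcProj η v from h.proj (u, v) e]
        exact .nil _
      · simp at e

open Classical in
/-- The separate edges can be chosen to correspond to the edges of `Δ` outside the image of `η`. -/
theorem FoldsOnto.exists_reduced (n : ℕ) : ∀ (S : Finset (Δ.Edge × ℕ))
    (L : Finset (ArcV Γ Δ × ArcV Γ Δ)), S.card ≤ n → FoldsOnto η S L →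
    ∃ S' L', FoldsOnto η S' L' ∧ L'.card + S.card ≤ L.card + S'.card ∧
      ∀ i ∈ S', ¬ InImage η i.1.1.1 i.1.1.2.1 i.1.1.2.2 ∧ ∀ j ∈ S', j.1 = i.1 → j = i := by
  induction n with
  | zero =>
    intro S L hS h
    obtain rfl := Finset.card_eq_zero.1 (Nat.le_zero.1 hS)
    exact ⟨∅, L, h, le_rfl, by simp⟩
  | succ n ih =>
    intro S L hS h
    by_cases hred : ∀ i ∈ S, ¬ InImage η i.1.1.1 i.1.1.2.1 i.1.1.2.2 ∧ ∀ j ∈ S, j.1 = i.1 → j = i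
    · exact ⟨S, L, h, le_rfl, hred⟩
    -- A redundant separate edge lies over an edge of the image or over the same edge as another
    -- separate edge. In either case it folds onto an edge that is kept.
    obtain ⟨i, hi, hbad⟩ : ∃ i ∈ S, InImage η i.1.1.1 i.1.1.2.1 i.1.1.2.2 ∨
        ∃ j ∈ S.erase i, j.1 = i.1 := by
      by_contra! hcon
      exact hred fun i hi => ⟨(hcon i hi).1, fun j hj hji => by
        by_contra hne
        exact (hcon i hi).2 j (Finset.mem_erase.2 ⟨hne, hj⟩) hji⟩
    have hsub : S.erase i ⊆ S := Finset.erase_subset _ _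
    obtain ⟨p, q, hpq, hp⟩ : ∃ p q, arcAdj Γ (S.erase i) p i.1.1.2.1 q ∧
        arcProj η p = i.1.1.1 := by
      rcases hbad with ⟨a, c, h, h1, h2⟩ | ⟨j, hj, hji⟩
      · exact ⟨.inl a, .inl c, .inl ⟨a, c, h, rfl, rfl⟩, h1⟩
      · exact ⟨.inr (j, false), .inr (j, true), .inr ⟨j, hj, rfl, by rw [hji], rfl⟩,
          congrArg (fun e : Δ.Edge => e.1.1) hji⟩
    have hadj : ∀ u y v, arcAdj Γ S u y v ↔ (arcAdj Γ (S.erase i) u y v ∨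
        (u = .inr (i, false) ∧ y = i.1.1.2.1 ∧ v = .inr (i, true))) := by
      intro u y v
      constructor
      · rintro (h | ⟨j, hj, h⟩)
        · exact .inl (.inl h)
        · by_cases hji : j = i
          · subst hji; exact .inr h
          · exact .inl (.inr ⟨j, Finset.mem_erase.2 ⟨hji, hj⟩, h⟩)
      · rintro ((h | ⟨j, hj, h⟩) | h)
        · exact .inl h
        · exact .inr ⟨j, hsub hj, h⟩
        · exact .inr ⟨i, hi, h⟩
    have hiso : ∀ s x (v : ArcV Γ Δ), ¬ arcAdj Γ (S.erase i) (.inr (i, s)) x v ∧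
        ¬ arcAdj Γ (S.erase i) v x (.inr (i, s)) := by
      intro s x v
      constructor
      · rintro h
        exact Finset.notMem_erase i S (arcAdj_active h).1
      · rintro h
        exact Finset.notMem_erase i S (arcAdj_active h).2
    have hpS : Active S p := (arcAdj_active hpq).1.mono hsub
    have hfold : ∀ {u v}, FoldG (arcAdj Γ S) (fun u v => (u, v) ∈ L) u v ↔
        FoldG (fun u y v => arcAdj Γ (S.erase i) u y v ∨
        (u = .inr (i, false) ∧ y = i.1.1.2.1 ∧ v = .inr (i, true)))
        (fun u v => (u, v) ∈ L) u v := fun {u v} =>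
      ⟨fun h => h.map id (fun u y v => (hadj u y v).1) (fun _ _ => .glue),
        fun h => h.map id (fun u y v => (hadj u y v).2) (fun _ _ => .glue)⟩
    obtain ⟨L', hc, hR, hQ, hL'⟩ := FoldG.remove_edge (a := .inr (i, false)) (c := .inr (i, true))
      (by simp) (hiso false) (hiso true) hpq
      (hfold.1 (h.fold (.inr (i, false)) p hi hpS hp.symm))
    have hact : ∀ u : ArcV Γ Δ, Active (S.erase i) u ↔
        Active S u ∧ u ≠ .inr (i, false) ∧ u ≠ .inr (i, true) := by
      rintro (a | ⟨j, s⟩)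
      · simp [Active]
      · cases s <;> simp [Active, and_comm]
    have h' : FoldsOnto η (S.erase i) L' := by
      refine ⟨⟨?_, ?_, fun j hj => h.hit j (hsub hj)⟩, ?_, ?_⟩
      · intro t ht
        have := hQ (Active S) h.active (fun u x v e =>
          ⟨(arcAdj_active e).1.mono hsub, (arcAdj_active e).2.mono hsub⟩) t ht
        exact ⟨(hact _).2 this.1, (hact _).2 this.2⟩
      · exact fun t ht => (hfold.2 (hR t ht)).arcProj_eq h.proj
      · intro u v hu hv huv
        obtain ⟨hu, hu1, hu2⟩ := (hact _).1 hu
        obtain ⟨hv, hv1, hv2⟩ := (hact _).1 hv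
        exact hL' u v hu1 hu2 hv1 hv2 (hfold.1 (h.fold u v hu hv huv))
      · intro e he
        rcases h.cover e he with h | ⟨j, hj, rfl⟩
        · exact .inl h
        · by_cases hji : j = i
          · subst hji
            exact hbad
          · exact .inr ⟨j, Finset.mem_erase.2 ⟨hji, hj⟩, rfl⟩
    have hcard := Finset.card_erase_add_one hi
    obtain ⟨S2, L2, h1, h2, h3⟩ := ih _ L' (by omega) h'
    exact ⟨S2, L2, h1, by omega, h3⟩

end Arcs

/-! ### The lower bound: back to pairs of vertices of Γ -/

section Lower

variable {B F : Type*} [Group F] {b : FreeGroupBasis B F} {Γ Δ : MultiCoreGraph B} {η : Hom Γ Δ}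
  {S : Finset (Δ.Edge × ℕ)} {L : Finset (ArcV Γ Δ × ArcV Γ Δ)}

theorem exists_edge_at (v : Δ.V) : ∃ (e : Δ.Edge) (s : Bool), (bif s then e.1.2.2 else e.1.1) = v := by
  by_contra! hcon
  have h1 : IsEmpty {p : B × Δ.V // Δ.Adj v p.1 p.2} :=
    ⟨fun p => hcon ⟨(v, p.1.1, p.1.2), p.2⟩ false rfl⟩
  have h2 : IsEmpty {p : Δ.V × B // Δ.Adj p.1 p.2 v} :=
    ⟨fun p => hcon ⟨(p.1.1, p.1.2, v), p.2⟩ true rfl⟩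
  have := Δ.two_le_degree v
  simp at this

-- The separate edges now correspond to the outer edges, which gives 2·|outE| end points. One end
-- point over each outer vertex is kept, and every other one is contracted at the gain of one pair.
-- The pairs over outer vertices do not interact with those of Γ and are dropped.
open Classical in
theorem FoldsOnto.exists_pairs [Finite B] (h : FoldsOnto η S L)
    (hred : ∀ i ∈ S, ¬ InImage η i.1.1.1 i.1.1.2.1 i.1.1.2.2 ∧ ∀ j ∈ S, j.1 = i.1 → j = i) :
    ∃ L' : Finset (Γ.V × Γ.V), (∀ p ∈ L', η.toFun p.1 = η.toFun p.2) ∧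
      (∀ a c, η.toFun a = η.toFun c → FoldG Γ.Adj (fun u v => (u, v) ∈ L') a c) ∧
      L'.card + 2 * (outE η).card ≤ L.card + (outV η).card := by
  have hSE : (outE η).card = S.card := by
    rw [← Finset.card_image_of_injOn (s := S) (f := Prod.fst)
      (fun i hi j hj hij => (hred j hj).2 i hi hij)]
    congr 1
    ext e
    rw [mem_outE, Finset.mem_image]
    constructor
    · rintro ⟨h1, h2⟩
      exact (h.cover e h1).resolve_left h2
    · rintro ⟨i, hi, rfl⟩
      exact ⟨h.hit i hi, (hred i hi).1⟩
  -- A separate edge folds with no other edge, since foldable edges have the same image in Δ. Hence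
  -- the separate edges can be discarded without changing the identifications.
  have hfold : ∀ u v : ArcV Γ Δ, Active S u → Active S v → arcProj η u = arcProj η v →
      FoldG (arcAdj Γ ∅) (fun u v => (u, v) ∈ L) u v := by
    intro u v hu hv huv
    refine (h.fold u v hu hv huv).le FoldG.equivalence (fun _ _ => .glue) ?_ ?_
    · rintro u u' x v v' (⟨a, c, e, rfl, rfl⟩ | ⟨i, hi, rfl, rfl, rfl⟩)
        (⟨a', c', e', rfl, rfl⟩ | ⟨j, hj, rfl, hx, rfl⟩) hf
      · exact .foldHeads (.inl ⟨a, c, e, rfl, rfl⟩) (.inl ⟨a', c', e', rfl, rfl⟩) hf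
      · have h1 : η.toFun a = j.1.1.1 := hf.arcProj_eq h.proj
        refine absurd ⟨a, c, hx ▸ e, h1, ?_⟩ (hred j hj).1
        have h2 := η.map_adj e
        rw [h1, hx] at h2
        exact Δ.out_unique h2 j.1.2
      · have h1 : i.1.1.1 = η.toFun a' := hf.arcProj_eq h.proj
        refine absurd ⟨a', c', e', h1.symm, ?_⟩ (hred i hi).1
        have h2 := η.map_adj e'
        rw [← h1] at h2
        exact Δ.out_unique h2 i.1.2
      · have h1 : i.1.1.1 = j.1.1.1 := hf.arcProj_eq h.proj
        have h2 := i.1.2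
        rw [h1, hx] at h2
        obtain rfl := (hred j hj).2 i hi
          (Subtype.ext (Prod.ext h1 (Prod.ext hx (Δ.out_unique h2 j.1.2))))
        exact .refl _
    · rintro u u' x v v' (⟨a, c, e, rfl, rfl⟩ | ⟨i, hi, rfl, rfl, rfl⟩)
        (⟨a', c', e', rfl, rfl⟩ | ⟨j, hj, rfl, hx, rfl⟩) hf
      · exact .foldTails (.inl ⟨a, c, e, rfl, rfl⟩) (.inl ⟨a', c', e', rfl, rfl⟩) hf
      · have h1 : η.toFun c = j.1.1.2.2 := hf.arcProj_eq h.proj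
        refine absurd ⟨a, c, hx ▸ e, ?_, h1⟩ (hred j hj).1
        have h2 := η.map_adj e
        rw [h1, hx] at h2
        exact Δ.in_unique h2 j.1.2
      · have h1 : i.1.1.2.2 = η.toFun c' := hf.arcProj_eq h.proj
        refine absurd ⟨a', c', e', ?_, h1.symm⟩ (hred i hi).1
        have h2 := η.map_adj e'
        rw [← h1] at h2
        exact Δ.in_unique h2 i.1.2
      · have h1 : i.1.1.2.2 = j.1.1.2.2 := hf.arcProj_eq h.proj
        have h2 := i.1.2
        rw [h1, hx] at h2
        obtain rfl := (hred j hj).2 i hi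
          (Subtype.ext (Prod.ext (Δ.in_unique h2 j.1.2) (Prod.ext hx h1)))
        exact .refl _
  -- Every outer vertex has an incident edge; that edge is outer and so is covered by a separate
  -- edge.
  have hrep : ∀ v : outV η, ∃ p : (Δ.Edge × ℕ) × Bool, p.1 ∈ S ∧
      arcProj η (.inr p : ArcV Γ Δ) = v.1 := by
    rintro ⟨v, hv⟩
    obtain ⟨hv1, hv2⟩ := mem_outV.1 hv
    obtain ⟨e, s, hs⟩ := exists_edge_at v
    have he : Hit η e.1.1 := by
      cases s
      · obtain rfl : e.1.1 = v := hs
        exact hv1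
      · obtain rfl : e.1.2.2 = v := hs
        exact hv1.of_comp_eq (comp_eq_of_adj e.2).symm
    rcases h.cover e he with ⟨a, c, -, h1, h2⟩ | ⟨i, hi, rfl⟩
    · refine absurd ?_ hv2
      cases s
      · exact ⟨a, h1.trans hs⟩
      · exact ⟨c, h2.trans hs⟩
    · exact ⟨(i, s), hi, hs⟩
  choose r hrS hr using hrep
  have hrinj : Function.Injective r := fun v w hvw => Subtype.ext (by rw [← hr v, ← hr w, hvw])
  let N0 : Finset ((Δ.Edge × ℕ) × Bool) := (S ×ˢ Finset.univ) \ (Finset.univ.image r)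
  let N : Finset (ArcV Γ Δ) := N0.map .inr
  have hN : N.card + (outV η).card = 2 * S.card := by
    have h1 : Finset.univ.image r ⊆ S ×ˢ Finset.univ := by
      intro p hp
      obtain ⟨v, -, rfl⟩ := Finset.mem_image.1 hp
      exact Finset.mem_product.2 ⟨hrS v, Finset.mem_univ _⟩
    have h2 : (Finset.univ.image r).card = (outV η).card := by
      rw [Finset.card_image_of_injective _ hrinj, Finset.card_univ, Fintype.card_coe]
    have h3 := Finset.card_le_card h1
    have h4 : (S ×ˢ (Finset.univ : Finset Bool)).card = 2 * S.card := by
      rw [Finset.card_product, Finset.card_univ, Fintype.card_bool, mul_comm]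
    rw [Finset.card_map, Finset.card_sdiff_of_subset h1]
    omega
  have hNinl : ∀ a, (Sum.inl a : ArcV Γ Δ) ∉ N := by simp [N]
  have hNinr : ∀ p : (Δ.Edge × ℕ) × Bool, (Sum.inr p : ArcV Γ Δ) ∈ N ↔
      p.1 ∈ S ∧ ∀ v, r v ≠ p := by
    intro p
    simp [N, N0]
  obtain ⟨L1, hc, hR, hQ, hL1⟩ := FoldG.contract_finset (Adj := arcAdj Γ ∅) N L
    (by
      intro u hu x v
      rcases u with a | p
      · exact absurd hu (hNinl a)
      · constructor
        · intro h
          exact absurd (arcAdj_active h).1 (Finset.notMem_empty _)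
        · intro h
          exact absurd (arcAdj_active h).2 (Finset.notMem_empty _))
    (by
      intro u hu
      rcases u with a | p
      · exact absurd hu (hNinl a)
      have hpS : Active S (.inr p : ArcV Γ Δ) := ((hNinr p).1 hu).1
      by_cases hran : arcProj η (.inr p : ArcV Γ Δ) ∈ Set.range η.toFun
      · obtain ⟨c, hc⟩ := hran
        exact ⟨.inl c, hNinl c, hfold _ _ hpS trivial hc.symm⟩
      · have hout := mem_outV.2 ⟨h.hit_of_active hpS, hran⟩
        refine ⟨.inr (r ⟨_, hout⟩), fun h => ((hNinr _).1 h).2 _ rfl,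
          hfold _ _ hpS (hrS _) (hr ⟨_, hout⟩).symm⟩)
  -- The separate end points that survive lie over outer vertices, so no remaining pair mixes them
  -- with vertices of Γ.
  have hentry : ∀ p ∈ L1, ∀ u : ArcV Γ Δ, u = p.1 ∨ u = p.2 →
      (∃ a, u = .inl a) ∨ arcProj η u ∉ Set.range η.toFun := by
    intro p hp u hu
    have hu' : Active S u ∧ u ∉ N := by
      have := hQ (Active S) h.active p hp
      rcases hu with rfl | rfl
      · exact this.1
      · exact this.2
    rcases u with a | q
    · exact .inl ⟨a, rfl⟩
    · refine .inr ?_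
      have h1 := hu'.2
      rw [hNinr] at h1
      push Not at h1
      obtain ⟨v, rfl⟩ := h1 hu'.1
      rw [hr]
      exact (mem_outV.1 v.2).2
  have hproj : ∀ p ∈ L1, arcProj η p.1 = arcProj η p.2 := fun p hp => (hR p hp).arcProj_eq h.proj
  let L2 : Finset (Γ.V × Γ.V) := L1.preimage (Prod.map Sum.inl Sum.inl)
    (Sum.inl_injective.prodMap Sum.inl_injective).injOn
  have hL2 : ∀ {a c}, (a, c) ∈ L2 ↔ ((.inl a, .inl c) : ArcV Γ Δ × ArcV Γ Δ) ∈ L1 := by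
    intro a c
    exact Finset.mem_preimage
  refine ⟨L2, ?_, ?_, ?_⟩
  · rintro ⟨a, c⟩ hp
    exact hproj _ (hL2.1 hp)
  · intro a c hac
    -- This relation lumps all separate end points into one class, which shows that identifications
    -- in Γ use only pairs in Γ.
    let R : ArcV Γ Δ → ArcV Γ Δ → Prop
      | .inl a, .inl c => FoldG Γ.Adj (fun u v => (u, v) ∈ L2) a c
      | .inr _, .inr _ => True
      | _, _ => False
    have hRe : Equivalence R := by
      refine ⟨?_, ?_, ?_⟩
      · rintro (a | p)
        · exact FoldG.refl _
        · trivial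
      · rintro (a | p) (c | q) h
        · exact FoldG.symm h
        · exact h
        · exact h
        · trivial
      · rintro (a | p) (c | q) (d | r) h h'
        · exact FoldG.trans h h'
        all_goals trivial
    refine FoldG.le (r := R) hRe ?_ ?_ ?_ (hL1 _ _ (hNinl a) (hNinl c)
      (hfold (.inl a) (.inl c) trivial trivial hac))
    · rintro (a | p) (c | q) h
      · exact FoldG.glue (hL2.2 h)
      · have := hproj _ h
        rcases hentry _ h (.inr q) (.inr rfl) with ⟨a, h⟩ | h'
        · simp at h
        · exact h' ⟨a, this⟩
      · have := hproj _ h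
        rcases hentry _ h (.inr p) (.inl rfl) with ⟨a, h⟩ | h'
        · simp at h
        · exact h' ⟨c, this.symm⟩
      · trivial
    · rintro u u' x v v' (⟨a, c, e, rfl, rfl⟩ | ⟨i, hi, -⟩) (⟨a', c', e', rfl, rfl⟩ | ⟨j, hj, -⟩) hf
      · exact FoldG.foldHeads e e' hf
      · simp at hj
      · simp at hi
      · simp at hi
    · rintro u u' x v v' (⟨a, c, e, rfl, rfl⟩ | ⟨i, hi, -⟩) (⟨a', c', e', rfl, rfl⟩ | ⟨j, hj, -⟩) hf
      · exact FoldG.foldTails e e' hf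
      · simp at hj
      · simp at hi
      · simp at hi
  · have : L2.card ≤ L1.card := Finset.card_le_card_of_injOn (Prod.map Sum.inl Sum.inl)
      (fun p hp => Finset.mem_preimage.1 hp)
      (Sum.inl_injective.prodMap Sum.inl_injective).injOn
    omega

/-- Expansion and reduction give at most |T| + |outE| pairs, and the contraction of end points then
removes 2·|outE| − |outV| of them. -/
theorem Gen.exists_pairs [Finite B] {T : Finset (Γ.V × F × Γ.V)} (hT : Gen b η T) :
    ∃ L : Finset (Γ.V × Γ.V), (∀ p ∈ L, η.toFun p.1 = η.toFun p.2) ∧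
      (∀ a c, η.toFun a = η.toFun c → FoldG Γ.Adj (fun u v => (u, v) ∈ L) a c) ∧
      L.card + (outE η).card ≤ T.card + (outV η).card := by
  classical
  obtain ⟨S, L, hc, h⟩ := hT.exists_foldsOnto
  obtain ⟨S', L', h', hc', hred⟩ := FoldsOnto.exists_reduced S.card S L le_rfl h
  obtain ⟨L2, h1, h2, h3⟩ := h'.exists_pairs hred
  have hSE : S'.card ≤ (outE η).card := by
    rw [← Finset.card_image_of_injOn (s := S') (f := Prod.fst)
      (fun i hi j hj hij => (hred j hj).2 i hi hij)]
    refine Finset.card_le_card fun e he => ?_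
    obtain ⟨i, hi, rfl⟩ := Finset.mem_image.1 he
    exact mem_outE.2 ⟨h'.hit i hi, (hred i hi).1⟩
  exact ⟨L2, h1, h2, by omega⟩

end Lower

/-! ### Norms of partitions and numbers of pairs -/

section PartitionNorm

variable {X : Type*} [Finite X]

theorem partitionNorm_add_card (P : Setoid X) :
    partitionNorm P + Nat.card (Quotient P) = Nat.card X := by
  classical
  have := Fintype.ofFinite X
  have := Fintype.ofFinite (Quotient P)
  have h1 : partitionNorm P = ∑ q : Quotient P, (Nat.card {x // Quotient.mk P x = q} - 1) := by
    have := Fintype.ofFinite P.classes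
    rw [partitionNorm, ← finsum_set_coe_eq_finsum_mem, finsum_eq_sum_of_fintype,
      ← Equiv.sum_comp (Setoid.quotientEquivClasses P)]
    refine Finset.sum_congr rfl fun q _ => ?_
    induction q using Quotient.inductionOn with
    | h a =>
      rw [Setoid.quotientEquivClasses_mk_eq, ← Nat.card_coe_set_eq]
      congr 1
      refine Nat.card_congr (Equiv.subtypeEquivRight fun x => ?_)
      exact (Quotient.eq (r := P)).symm
  have h2 : Nat.card X = ∑ q : Quotient P, Nat.card {x // Quotient.mk P x = q} := by
    rw [← Nat.card_sigma]
    exact (Nat.card_congr (Equiv.sigmaFiberEquiv (Quotient.mk P))).symm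
  have h3 : Nat.card (Quotient P) = ∑ q : Quotient P, 1 := by simp
  rw [h1, h2, h3, ← Finset.sum_add_distrib]
  refine Finset.sum_congr rfl fun q _ => Nat.sub_add_cancel ?_
  induction q using Quotient.inductionOn with
  | h a =>
    have : Nonempty {x // Quotient.mk P x = Quotient.mk P a} := ⟨⟨a, rfl⟩⟩
    exact Nat.card_pos

-- Join every element to the chosen representative of its block; a block β needs |β| − 1 such pairs.
open Classical in
theorem exists_pairs_card_le_partitionNorm (P : Setoid X) :
    ∃ L : Finset (X × X), L.card ≤ partitionNorm P ∧ (∀ p ∈ L, P p.1 p.2) ∧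
      ∀ u v, P u v → Relation.EqvGen (fun u v => (u, v) ∈ L) u v := by
  have := Fintype.ofFinite X
  have := Fintype.ofFinite (Quotient P)
  let f : X → X := fun x => (Quotient.mk P x).out
  let N := (Finset.univ : Finset X).filter fun x => f x ≠ x
  refine ⟨N.image fun x => (x, f x), ?_, ?_, ?_⟩
  · have h1 := partitionNorm_add_card P
    have h2 : (Finset.univ.filter fun x => f x = x).card + N.card = Fintype.card X :=
      Finset.card_filter_add_card_filter_not _
    have h3 : Fintype.card (Quotient P) ≤ (Finset.univ.filter fun x => f x = x).card := by
      rw [← Finset.card_univ]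
      refine Finset.card_le_card_of_injOn Quotient.out (fun q _ => ?_)
        (Quotient.out_injective.injOn)
      simp [f]
    have h4 : (N.image fun x => (x, f x)).card ≤ N.card := Finset.card_image_le
    simp only [Nat.card_eq_fintype_card] at h1
    omega
  · intro p hp
    obtain ⟨x, -, rfl⟩ := Finset.mem_image.1 hp
    exact P.symm (Quotient.mk_out (s := P) x)
  · have hx : ∀ x, Relation.EqvGen (fun u v => (u, v) ∈ N.image fun x => (x, f x)) x (f x) := by
      intro x
      by_cases h : f x = x
      · rw [h]; exact .refl _
      · exact .rel _ _ (Finset.mem_image.2 ⟨x, Finset.mem_filter.2 ⟨Finset.mem_univ _, h⟩, rfl⟩)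
    intro u v huv
    have : f u = f v := congrArg Quotient.out (Quotient.sound huv)
    exact (hx u).trans _ _ _ (this ▸ (hx v).symm _ _)

-- The norm is the number of points minus the number of blocks, and each further pair lowers the
-- number of blocks by at most one.
open Classical in
theorem partitionNorm_eqvGen_le (L : Finset (X × X)) :
    partitionNorm (Relation.EqvGen.setoid fun u v => (u, v) ∈ L) ≤ L.card := by
  suffices h : Nat.card X ≤
      L.card + Nat.card (Quotient (Relation.EqvGen.setoid fun u v => (u, v) ∈ L)) by
    have := partitionNorm_add_card (Relation.EqvGen.setoid fun u v => (u, v) ∈ L)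
    omega
  induction L using Finset.induction_on with
  | empty =>
    rw [Finset.card_empty, zero_add]
    refine Nat.card_le_card_of_injective (Quotient.mk _) fun u v h => ?_
    have h' : Relation.EqvGen (fun u v : X => (u, v) ∈ (∅ : Finset (X × X))) u v :=
      Quotient.exact h
    clear h
    induction h' with
    | rel u v h => simp at h
    | refl u => rfl
    | symm u v _ ih => exact ih.symm
    | trans u v w _ _ ih ih' => exact ih.trans ih'
  | insert t L ht ih =>
    obtain ⟨a, c⟩ := t
    rw [Finset.card_insert_of_notMem ht]
    let s : Setoid X := Relation.EqvGen.setoid fun u v => (u, v) ∈ L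
    let s' : Setoid X := Relation.EqvGen.setoid fun u v => (u, v) ∈ insert (a, c) L
    have hss : ∀ u v, s u v → s' u v := fun u v h =>
      Relation.EqvGen.mono (r := fun u v => (u, v) ∈ L) (fun _ _ h => Finset.mem_insert_of_mem h) _ _ h
    -- Sending the class of `a` to that of `c` gives a map that is constant on the new classes. So
    -- old classes other than that of `a` stay distinct, and `none` accounts for the class of `a`.
    let κ : X → Quotient s := fun x => if Quotient.mk s x = Quotient.mk s a then Quotient.mk s c
      else Quotient.mk s x
    have hκ : ∀ u v, s' u v → κ u = κ v := by
      intro u v h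
      change Relation.EqvGen _ u v at h
      induction h with
      | rel u v h =>
        rcases Finset.mem_insert.1 h with h | h
        · cases h
          by_cases hc : Quotient.mk s c = Quotient.mk s a <;> simp [κ, hc]
        · have : Quotient.mk s u = Quotient.mk s v := Quotient.sound (.rel _ _ h)
          simp [κ, this]
      | refl u => rfl
      | symm u v _ ih => exact ih.symm
      | trans u v w _ _ ih ih' => exact ih.trans ih'
    let g : Quotient s → Option (Quotient s') := fun q => if q = Quotient.mk s a then none else
      some (Quotient.lift (Quotient.mk s') (fun u v h => Quotient.sound (hss u v h)) q)
    have hg : Function.Injective g := by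
      intro q q' h
      induction q using Quotient.inductionOn with
      | h u =>
      induction q' using Quotient.inductionOn with
      | h v =>
      by_cases h1 : Quotient.mk s u = Quotient.mk s a <;>
        by_cases h2 : Quotient.mk s v = Quotient.mk s a
      · exact h1.trans h2.symm
      · simp [g, h1, h2] at h
      · simp [g, h1, h2] at h
      · simp only [g, if_neg h1, if_neg h2, Option.some.injEq, Quotient.lift_mk] at h
        have := hκ u v (Quotient.exact h)
        simpa only [κ, if_neg h1, if_neg h2] using this
    have := Nat.card_le_card_of_injective g hg
    rw [Finite.card_option] at this
    change Nat.card X ≤ L.card + Nat.card (Quotient s) at ih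
    change Nat.card X ≤ L.card + 1 + Nat.card (Quotient s')
    omega

end PartitionNorm

/-! ### The B-norm as a minimal number of generating pairs -/

section BNorm

variable {B : Type*} {Γ Δ : MultiCoreGraph B} {η : Hom Γ Δ}

theorem foldRel_iff {P : Setoid Γ.V} {a c : Γ.V} : FoldRel P a c ↔ FoldG Γ.Adj P a c := by
  constructor
  · intro h
    induction h with
    | glue h => exact .glue h
    | symm _ ih => exact ih.symm
    | trans _ _ ih ih' => exact ih.trans ih'
    | foldHeads e e' _ ih => exact .foldHeads e e' ih
    | foldTails e e' _ ih => exact .foldTails e e' ih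
  · intro h
    refine FoldG.le (r := FoldRel P) (foldSetoid P).iseqv (fun _ _ => .glue) ?_ ?_ h
    · exact fun _ _ _ _ _ => .foldHeads
    · exact fun _ _ _ _ _ => .foldTails

theorem foldG_apply_eq {P : Γ.V → Γ.V → Prop} (hP : ∀ u v, P u v → η.toFun u = η.toFun v)
    {u v : Γ.V} (h : FoldG Γ.Adj P u v) : η.toFun u = η.toFun v :=
  h.apply_eq (AdjX := Δ.Adj) η.toFun (fun _ _ _ _ => Δ.out_unique) (fun _ _ _ _ => Δ.in_unique)
    (fun _ _ _ => η.map_adj) hP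

/-- The pairs may be replaced by the equivalence relation they generate: this has the same fold
closure, and its norm is at most the number of pairs. -/
theorem bNorm_le (hη : η.Surjective) {L : Finset (Γ.V × Γ.V)}
    (hL : ∀ p ∈ L, η.toFun p.1 = η.toFun p.2)
    (hfold : ∀ a c, η.toFun a = η.toFun c → FoldG Γ.Adj (fun u v => (u, v) ∈ L) a c) :
    BNorm η ≤ L.card := by
  refine le_trans (Nat.sInf_le ⟨_, ⟨hη, Setoid.ext fun a c => ?_⟩, rfl⟩)
    (partitionNorm_eqvGen_le L)
  refine foldRel_iff.trans ⟨fun h => ?_, fun h => ?_⟩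
  · refine foldG_apply_eq (fun u v h => ?_) h
    change Relation.EqvGen _ u v at h
    induction h with
    | rel u v h => exact hL _ h
    | refl u => rfl
    | symm u v _ ih => exact ih.symm
    | trans u v w _ _ ih ih' => exact ih.trans ih'
  · exact (hfold a c h).bind fun u v h => .glue (.rel _ _ h)

theorem exists_pairs_card_le_bNorm (hη : η.Surjective) : ∃ L : Finset (Γ.V × Γ.V),
    L.card ≤ BNorm η ∧ (∀ p ∈ L, η.toFun p.1 = η.toFun p.2) ∧
      ∀ a c, η.toFun a = η.toFun c → FoldG Γ.Adj (fun u v => (u, v) ∈ L) a c := by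
  obtain ⟨P, ⟨-, hP⟩, hn⟩ := Nat.sInf_mem (s := {n | ∃ P : Setoid Γ.V, Generates P η ∧
    partitionNorm P = n}) ⟨_, _, generates_ker hη, rfl⟩
  have hker : ∀ a c, FoldG Γ.Adj P a c ↔ η.toFun a = η.toFun c := fun a c => by
    rw [← foldRel_iff]
    exact Setoid.ext_iff.1 hP a c
  obtain ⟨L, h1, h2, h3⟩ := exists_pairs_card_le_partitionNorm P
  refine ⟨L, h1.trans hn.le, fun p hp => (hker _ _).1 (.glue (h2 p hp)), fun a c hac => ?_⟩
  refine ((hker a c).2 hac).bind fun u v h => ?_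
  have := h3 u v h
  clear h
  induction this with
  | rel u v h => exact .glue h
  | refl u => exact .refl _
  | symm u v _ ih => exact ih.symm
  | trans u v w _ _ ih ih' => exact ih.trans ih'

end BNorm

/-! ### Counting vertices and edges of Δ relative to the image -/

section Chi

variable {B : Type*} {Γ Δ : MultiCoreGraph B} {η : Hom Γ Δ}

theorem card_image_V [Finite B] (η : Hom Γ Δ) : Nat.card η.image.V = Nat.card (Set.range η.toFun) := rfl

theorem card_image_Edge [Finite B] (η : Hom Γ Δ) :
    Nat.card η.image.Edge = Nat.card {e : Δ.Edge // InImage η e.1.1 e.1.2.1 e.1.2.2} := by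
  refine Nat.card_eq_of_bijective
    (fun e => ⟨⟨(e.1.1.1, e.1.2.1, e.1.2.2.1), η.imageIncl.map_adj e.2⟩, e.2⟩) ⟨?_, ?_⟩
  · rintro ⟨⟨⟨p, hp⟩, x, ⟨q, hq⟩⟩, h⟩ ⟨⟨⟨p', hp'⟩, x', ⟨q', hq'⟩⟩, h'⟩ e
    have e1 : (p, x, q) = (p', x', q') := congrArg (fun t => t.1.1) e
    cases e1
    rfl
  · rintro ⟨⟨⟨p, x, q⟩, h⟩, a, c, h', h1, h2⟩
    exact ⟨⟨(⟨p, a, h1⟩, x, ⟨q, c, h2⟩), a, c, h', h1, h2⟩, rfl⟩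

open Classical in
theorem card_not_hit_eq_sum [Fintype Δ.Component] {X : Type*} [Fintype X] (f : X → Δ.V) :
    ((Finset.univ.filter fun x => ¬ Hit η (f x)).card : ℤ) =
      ∑ C ∈ Finset.univ.filter (fun C : Δ.Component => ¬ ∃ D, η.mapComp D = C),
        (Nat.card {x // Δ.comp (f x) = C} : ℤ) := by
  rw [Finset.card_eq_sum_card_fiberwise (f := fun x => Δ.comp (f x))
    (t := Finset.univ.filter (fun C : Δ.Component => ¬ ∃ D, η.mapComp D = C))
    (fun x hx => by simpa [hit_iff] using hx), Nat.cast_sum]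
  refine Finset.sum_congr rfl fun C hC => ?_
  rw [Nat.card_eq_fintype_card, Fintype.card_subtype, Finset.filter_filter]
  congr 2
  ext x
  simp only [Finset.mem_filter, Finset.mem_univ, true_and, and_iff_right_iff_imp]
  rintro rfl
  exact hit_iff.not.2 (Finset.mem_filter.1 hC).2

-- Each vertex or edge of Δ lies in the image, outside the image in a component that meets it, or in
-- a missed component.
open Classical in
theorem image_chi_sub_chi [Finite B] [Fintype Δ.Component] (η : Hom Γ Δ) :
    η.image.chi - Δ.chi = ((outE η).card : ℤ) - (outV η).card -
      ∑ C ∈ Finset.univ.filter (fun C : Δ.Component => ¬ ∃ D, η.mapComp D = C), Δ.compChi C := by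
  have := Fintype.ofFinite Δ.V
  have := Fintype.ofFinite Δ.Edge
  have hV : (Nat.card Δ.V : ℤ) = Nat.card η.image.V + (outV η).card +
      (Finset.univ.filter fun p : Δ.V => ¬ Hit η p).card := by
    have h1 : Nat.card η.image.V =
        (Finset.univ.filter fun p : Δ.V => p ∈ Set.range η.toFun).card := by
      rw [card_image_V, Nat.card_eq_fintype_card, ← Fintype.card_subtype]
    have h2 : outV η = (Finset.univ.filter fun p : Δ.V => ¬ p ∈ Set.range η.toFun).filter
        (fun p => Hit η p) := by
      ext p; simp [mem_outV, and_comm]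
    have h3 : (Finset.univ.filter fun p : Δ.V => ¬ Hit η p) =
        (Finset.univ.filter fun p : Δ.V => ¬ p ∈ Set.range η.toFun).filter
        (fun p => ¬ Hit η p) := by
      ext p
      simp only [Finset.mem_filter, Finset.mem_univ, true_and]
      refine ⟨fun h => ⟨?_, h⟩, fun h => h.2⟩
      rintro ⟨a, rfl⟩
      exact h (hit_apply a)
    rw [h1, h2, h3, add_assoc, ← Nat.cast_add (Finset.card _) (Finset.card _),
      Finset.card_filter_add_card_filter_not, ← Nat.cast_add,
      Finset.card_filter_add_card_filter_not, Finset.card_univ, Nat.card_eq_fintype_card]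
  have hE : (Nat.card Δ.Edge : ℤ) = Nat.card η.image.Edge + (outE η).card +
      (Finset.univ.filter fun e : Δ.Edge => ¬ Hit η e.1.1).card := by
    have h1 : Nat.card η.image.Edge =
        (Finset.univ.filter fun e : Δ.Edge => InImage η e.1.1 e.1.2.1 e.1.2.2).card := by
      rw [card_image_Edge, Nat.card_eq_fintype_card, ← Fintype.card_subtype]
    have h2 : outE η = (Finset.univ.filter
        fun e : Δ.Edge => ¬ InImage η e.1.1 e.1.2.1 e.1.2.2).filter (fun e => Hit η e.1.1) := by
      ext e; simp [mem_outE, and_comm]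
    have h3 : (Finset.univ.filter fun e : Δ.Edge => ¬ Hit η e.1.1) = (Finset.univ.filter
        fun e : Δ.Edge => ¬ InImage η e.1.1 e.1.2.1 e.1.2.2).filter (fun e => ¬ Hit η e.1.1) := by
      ext e
      simp only [Finset.mem_filter, Finset.mem_univ, true_and]
      refine ⟨fun h => ⟨?_, h⟩, fun h => h.2⟩
      rintro ⟨a, c, -, h', -⟩
      exact h (h' ▸ hit_apply a)
    rw [h1, h2, h3, add_assoc, ← Nat.cast_add (Finset.card _) (Finset.card _),
      Finset.card_filter_add_card_filter_not, ← Nat.cast_add,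
      Finset.card_filter_add_card_filter_not, Finset.card_univ, Nat.card_eq_fintype_card]
  have hs : ∑ C ∈ Finset.univ.filter (fun C : Δ.Component => ¬ ∃ D, η.mapComp D = C),
      Δ.compChi C = ((Finset.univ.filter fun p : Δ.V => ¬ Hit η p).card : ℤ) -
      (Finset.univ.filter fun e : Δ.Edge => ¬ Hit η e.1.1).card := by
    rw [card_not_hit_eq_sum (fun p => p), card_not_hit_eq_sum (fun e : Δ.Edge => e.1.1), ← Finset.sum_sub_distrib]
    rfl
  rw [hs, chi, chi, hV, hE]
  ring

theorem Hom.Surjective.image_chi_eq [Finite B] (hη : η.Surjective) : η.image.chi = Δ.chi := by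
  have hV : Nat.card η.image.V = Nat.card Δ.V := by
    rw [card_image_V, Set.range_eq_univ.2 hη.1]
    exact Nat.card_congr (Equiv.Set.univ _)
  have hE : Nat.card η.image.Edge = Nat.card Δ.Edge := by
    rw [card_image_Edge]
    exact Nat.card_congr (Equiv.subtypeUnivEquiv fun e => hη.2 e.2)
  rw [chi, chi, hV, hE]

/-- Which partitions generate a surjective morphism depends only on its fibers, and restricting the
codomain to the image does not change these. -/
theorem Hom.Surjective.bNorm_toImage [Finite B] (hη : η.Surjective) : BNorm η.toImage = BNorm η := by
  have hker : Setoid.ker η.toImage.toFun = Setoid.ker η.toFun :=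
    Setoid.ext fun a c => Subtype.ext_iff
  have : ∀ P, Generates P η.toImage ↔ Generates P η := fun P => by
    rw [Generates, Generates, hker, and_iff_right η.toImage_surjective, and_iff_right hη]
  simp only [BNorm, this]

end Chi

/-! ### The norm formula -/

section Main

variable {B F : Type*} [Group F] {Γ Δ : MultiCoreGraph B}

theorem toImage_eq_iff [Finite B] {η : Hom Γ Δ} {a c : Γ.V} :
    η.toImage.toFun a = η.toImage.toFun c ↔ η.toFun a = η.toFun c := Subtype.ext_iff

/-- Triples that generate the groupoid induced from `Δ`, as few as the `B`-norm permits. -/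
theorem exists_gen_card_le [Finite B] (b : FreeGroupBasis B F) (η : Hom Γ Δ) : ∃ T : Finset (Γ.V × F × Γ.V),
    Gen b η T ∧ T.card + (outV η).card ≤ BNorm η.toImage + (outE η).card := by
  obtain ⟨L, h1, h2, h3⟩ := exists_pairs_card_le_bNorm η.toImage_surjective
  obtain ⟨T, hT, hc⟩ := exists_gen_of_foldG b (η := η) (L := L)
    (fun p hp => toImage_eq_iff.1 (h2 p hp)) (fun a c h => h3 a c (toImage_eq_iff.2 h))
  exact ⟨T, hT, hc.trans (Nat.add_le_add_right h1 _)⟩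

theorem Gen.bNorm_le [Finite B] {b : FreeGroupBasis B F} {η : Hom Γ Δ} {T : Finset (Γ.V × F × Γ.V)}
    (hT : Gen b η T) : BNorm η.toImage + (outE η).card ≤ T.card + (outV η).card := by
  obtain ⟨L, h1, h2, h3⟩ := hT.exists_pairs
  exact (Nat.add_le_add_right (MultiCoreGraph.bNorm_le η.toImage_surjective
    (fun p hp => toImage_eq_iff.2 (h1 p hp)) (fun a c h => h2 a c (toImage_eq_iff.1 h))) _).trans h3

-- Besides bounding the norms from above, this shows that a chain exists, so that the minimum
-- defining the norm is attained.
open Classical in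
theorem Gen.exists_immediateChain {b : FreeGroupBasis B F} {η : Hom Γ Δ}
    {T : Finset (Γ.V × F × Γ.V)} (hT : Gen b η T) {C : Δ.Component}
    (hC : ∃ D, η.mapComp D = C) :
    ∃ n ≤ (T.filter fun t => Δ.comp (η.toFun t.1) = C).card,
      ImmediateChain (targetGroup b Δ C) n (fiberGroups b η C) {targetGroup b Δ C} := by
  let _ := Fintype.ofFinite {D : Γ.Component // η.mapComp D = C}
  obtain ⟨T', hc, hfull⟩ := hT.exists_full hC
  obtain ⟨n, hn, h⟩ := (hfull Finset.univ (fun _ => Finset.mem_univ _)).exists_immediateChain _ _ _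
    T' le_rfl ⟨⟨_, hC.choose_spec⟩, Finset.mem_univ _⟩ (fun D _ => fiberGroup_le b η C D)
  exact ⟨n, hn.trans hc, h⟩

open Classical in
/-- The sum of the norms over the components of `Δ` that meet the image. -/
theorem sum_subgroupNorm [Finite B] [Fintype Δ.Component] (b : FreeGroupBasis B F) (η : Hom Γ Δ) :
    (∑ C ∈ Finset.univ.filter (fun C : Δ.Component => ∃ D, η.mapComp D = C),
      subgroupNorm (targetGroup b Δ C) (fiberGroups b η C)) + (outV η).card =
    BNorm η.toImage + (outE η).card := by
  obtain ⟨T, hT, hc⟩ := exists_gen_card_le b η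
  apply le_antisymm
  -- A single optimal `T` splits into the parts over the components of Δ, and each part bounds the
  -- norm of its component.
  · refine le_trans (Nat.add_le_add_right ?_ _) hc
    calc _ ≤ ∑ C ∈ Finset.univ.filter (fun C : Δ.Component => ∃ D, η.mapComp D = C),
          (T.filter fun t => Δ.comp (η.toFun t.1) = C).card := by
          refine Finset.sum_le_sum fun C hC => ?_
          obtain ⟨n, hn, h⟩ := hT.exists_immediateChain (Finset.mem_filter.1 hC).2
          exact (Nat.sInf_le h).trans hn
      _ = T.card := (Finset.card_eq_sum_card_fiberwise fun t _ =>
          Finset.mem_filter.2 ⟨Finset.mem_univ _, _, Hom.mapComp_comp η t.1⟩).symm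
  -- Conversely, shortest chains for the components that meet the image yield triples that assemble
  -- to one generating set; missed components contribute no triples.
  · have hT' : ∀ C, ∃ T' : Finset ({D // η.mapComp D = C} × F × {D // η.mapComp D = C}),
        T'.card ≤ (if ∃ D, η.mapComp D = C then
          subgroupNorm (targetGroup b Δ C) (fiberGroups b η C) else 0) ∧
        ((∃ D, η.mapComp D = C) → Full (targetGroup b Δ C)
          (@Finset.univ {D // η.mapComp D = C} (Fintype.ofFinite _)) (fiberGroup b η C) T') := by
      intro C
      by_cases hC : ∃ D, η.mapComp D = C
      · obtain ⟨n, -, h⟩ := hT.exists_immediateChain hC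
        have hmem : ImmediateChain (targetGroup b Δ C)
            (subgroupNorm (targetGroup b Δ C) (fiberGroups b η C)) (fiberGroups b η C)
            {targetGroup b Δ C} := Nat.sInf_mem (s := {n | ImmediateChain (targetGroup b Δ C) n
              (fiberGroups b η C) {targetGroup b Δ C}}) ⟨n, h⟩
        obtain ⟨T', h1, h2⟩ := hmem.exists_full rfl
          (@Finset.univ {D // η.mapComp D = C} (Fintype.ofFinite _)) (fiberGroup b η C) rfl
        exact ⟨T', by rwa [if_pos hC], fun _ => h2⟩
      · exact ⟨∅, by simp, fun h => absurd h hC⟩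
    choose T' hT1 hT2 using hT'
    obtain ⟨T2, hc2, hG⟩ := exists_gen_of_full T' _
      (fun C D => @Finset.mem_univ _ (Fintype.ofFinite _) D) hT2
    refine hG.bNorm_le.trans (Nat.add_le_add_right (hc2.trans ?_) _)
    rw [Finset.sum_filter]
    exact Finset.sum_le_sum fun C _ => hT1 C

theorem algNorm_eq [Finite B] (b : FreeGroupBasis B F) (η : Hom Γ Δ) :
    algNorm b η = (BNorm η.toImage : ℤ) + (η.image.chi - Δ.chi) := by
  classical
  have := Fintype.ofFinite Δ.Component
  have h1 := sum_subgroupNorm b η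
  have h2 : algNorm b η =
      ∑ C ∈ Finset.univ.filter (fun C : Δ.Component => ∃ D, η.mapComp D = C),
        (subgroupNorm (targetGroup b Δ C) (fiberGroups b η C) : ℤ) -
      ∑ C ∈ Finset.univ.filter (fun C : Δ.Component => ¬ ∃ D, η.mapComp D = C), Δ.compChi C := by
    rw [algNorm, finsum_eq_sum_of_fintype, sub_eq_add_neg, ← Finset.sum_neg_distrib,
      ← Finset.sum_ite]
    rfl
  rw [h2, image_chi_sub_chi, ← Nat.cast_sum]
  zify at h1 ⊢
  linarith

end Main

end MultiCoreGraph

theorem mainTheorem9 {B : Type*} [Finite B] {F : Type*} [Group F] (b : FreeGroupBasis B F)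
    {Γ Δ : MultiCoreGraph B} (η : MultiCoreGraph.Hom Γ Δ) :
    (∀ C : Δ.Component, (∃ D, η.mapComp D = C) →
      ∃ n, MultiCoreGraph.ImmediateChain (MultiCoreGraph.targetGroup b Δ C) n
        (MultiCoreGraph.fiberGroups b η C) {MultiCoreGraph.targetGroup b Δ C}) ∧
    MultiCoreGraph.algNorm b η =
      (MultiCoreGraph.BNorm η.toImage : ℤ) + (η.image.chi - Δ.chi) ∧
    (η.Surjective → MultiCoreGraph.algNorm b η = (MultiCoreGraph.BNorm η : ℤ)) := by
  refine ⟨fun C hC => ?_, MultiCoreGraph.algNorm_eq b η, fun hη => ?_⟩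
  · obtain ⟨T, hT, -⟩ := MultiCoreGraph.exists_gen_card_le b η
    obtain ⟨n, -, h⟩ := hT.exists_immediateChain hC
    exact ⟨n, h⟩
  · rw [MultiCoreGraph.algNorm_eq, hη.image_chi_eq, hη.bNorm_toImage, sub_self, add_zero]
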